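/- Let $F$ be a connected compact simple Lie group with Lie algebra $\mathfrak f$ and Killing form $B$, and let $n\ge 1$. The group $F^{n+1}$ acts transitively on $F^n$ by $(a_1,\dots,a_{n+1})\circ(x_1,\dots,x_n)=(a_1x_1a_{n+1}^{-1},\dots,a_nx_na_{n+1}^{-1})$ with isotropy group $\mathrm{diag}(F)$ at the unit; this identifies $F^{n+1}/\mathrm{diag}(F)$ with $F^n$, and the invariant Riemannian metrics on $F^{n+1}/\mathrm{diag}(F)$ with the left-invariant metrics on $F^n$ given by the inner products on $\mathfrak g=n\mathfrak f=\mathfrak f\oplus\dots\oplus\mathfrak f$ that are $\mathrm{ad}(\mathfrak h)$-invariant, where $\mathfrak h=\{(Z,\dots,Z): Z\in\mathfrak f\}$. Let $M$ be the set of those inner products which have volume $1$ with respect to minus the Killing form of $\mathfrak g$ (each invariant metric is homothetic to exactly one of them), and let $S:M\to\mathbb R$ be the scalar curvature of the corresponding metrics. A non-degenerate $n\times n$ matrix $A=(\alpha_{ij})$ generates the inner product on $\mathfrak g$ for which the vectors $(\alpha_{i1}X_a,\dots,\alpha_{in}X_a)$ form an orthonormal basis, where $(X_a)$ is a basis of $\mathfrak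 f$ that is orthonormal for $-B$. For $k\ge 1$ let $A_k^{st}=\sqrt{\tfrac{4(k+1)}{k+3}}\,(a_{ij})_{1\le i,j\le k}$ with $a_{ij}=\frac1{\sqrt{(k-i+1)(k-i+2)}}$ for $j<i$, $a_{ii}=\sqrt{\tfrac{k-i+2}{k-i+1}}$, and $a_{ij}=0$ for $j>i$ (it generates a multiple of the standard metric of $F^{k+1}/\mathrm{diag}(F)$, with Einstein constant $1$). An invariant Einstein metric is called routine if it is isometric, up to a positive constant multiple, to a metric generated by a block-diagonal matrix $\mathrm{diag}(A_{k_1}^{st},\dots,A_{k_l}^{st})$ with $n=k_1+\dots+k_l$ and all $k_i\ge1$. Let $CPS(n)\in\mathbb N\cup\{\infty\}$ be the number of critical points of $S$ on $M$, and let $REM(n)$ be the number of those critical points that are routine Einstein metrics. Then $$CPS(n)\ \ge\ REM(n)\ \ge\ (1+\sqrt2)^{\,n-1}.$$ -/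

import Mathlib

open scoped Manifold ContDiff

noncomputable section

namespace LedgerObata

/-! ### Left-invariant metrics on a Lie group, in terms of the Lie algebra `L` of left-invariant
vector fields -/

section Curvature

variable {L : Type*} [LieRing L] [LieAlgebra ℝ L]

/-- `Q` is an inner product. -/
structure IsInnerProduct (Q : LinearMap.BilinForm ℝ L) : Prop where
  symm : ∀ x y, Q x y = Q y x
  pos : ∀ x, x ≠ 0 → 0 < Q x x

/-- `D` is the Levi-Civita connection (restricted to left-invariant fields) of the left-invariant
metric given by `Q`: it is torsion-free and metric. -/
structure IsLeviCivita (Q : LinearMap.BilinForm ℝ L) (D : L →ₗ[ℝ] L →ₗ[ℝ] L) : Prop where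
  torsionFree : ∀ x y, D x y - D y x = ⁅x, y⁆
  metric : ∀ x y z, Q (D x y) z + Q y (D x z) = 0

open Classical in
/-- The Levi-Civita connection of the left-invariant metric given by `Q`; it exists and is unique
whenever `Q` is an inner product (on a finite-dimensional `L`). -/
def leviCivita (Q : LinearMap.BilinForm ℝ L) : L →ₗ[ℝ] L →ₗ[ℝ] L :=
  if h : ∃ D, IsLeviCivita Q D then h.choose else 0

/-- The linear map `x ↦ R(x, y) z = D_x D_y z - D_y D_x z - D_[x,y] z`. -/
def curvature (Q : LinearMap.BilinForm ℝ L) (y z : L) : L →ₗ[ℝ] L :=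
  (leviCivita Q).flip (leviCivita Q y z) - leviCivita Q y ∘ₗ (leviCivita Q).flip z
    + (leviCivita Q).flip z ∘ₗ (LieAlgebra.ad ℝ L y : L →ₗ[ℝ] L)

/-- The Ricci curvature `Ric(y, z) = tr (x ↦ R(x, y) z)`. -/
def ricci (Q : LinearMap.BilinForm ℝ L) (y z : L) : ℝ :=
  LinearMap.trace ℝ L (curvature Q y z)

/-- The left-invariant metric given by `Q` is an Einstein metric. -/
def IsEinstein (Q : LinearMap.BilinForm ℝ L) : Prop :=
  ∃ c : ℝ, ∀ y z, ricci Q y z = c * Q y z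

variable [FiniteDimensional ℝ L]

/-- The Gram matrix of a bilinear function in a fixed basis of `L`. -/
def gram (Q : L → L → ℝ) :
    Matrix (Fin (Module.finrank ℝ L)) (Fin (Module.finrank ℝ L)) ℝ :=
  Matrix.of fun i j => Q (Module.finBasis ℝ L i) (Module.finBasis ℝ L j)

/-- The scalar curvature `∑ g^{ij} Ric_{ij}`; it does not depend on the basis. -/
def scalarCurvature (Q : LinearMap.BilinForm ℝ L) : ℝ :=
  ((gram fun x y => Q x y)⁻¹ * gram (ricci Q)).trace

/-- `Q` has volume one with respect to the inner product `K`, i.e. both define the same volume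
density; this does not depend on the basis. -/
def HasUnitVolume (K Q : LinearMap.BilinForm ℝ L) : Prop :=
  (gram fun x y => Q x y).det = (gram fun x y => K x y).det

end Curvature

/-! ### Invariant metrics on `Fⁿ = Fⁿ⁺¹ / diag F`, in terms of the Lie algebra `f` of `F` -/

section Metrics

variable {f : Type*} [LieRing f] [LieAlgebra ℝ f] {n : ℕ}

/-- The direct sum `n f = f ⊕ ⋯ ⊕ f` with the componentwise bracket. -/
instance powLieRing : LieRing (Fin n → f) where
  bracket x y := fun i => ⁅x i, y i⁆
  add_lie _ _ _ := funext fun _ => add_lie _ _ _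
  lie_add _ _ _ := funext fun _ => lie_add _ _ _
  lie_self _ := funext fun _ => lie_self _
  leibniz_lie _ _ _ := funext fun _ => leibniz_lie _ _ _

instance powLieAlgebra : LieAlgebra ℝ (Fin n → f) where
  lie_smul c _ _ := funext fun _ => lie_smul c _ _

variable (n) in
/-- The element `(Z, …, Z)` of the diagonal subalgebra of `n f`. -/
def diag (Z : f) : Fin n → f := fun _ => Z

/-- `Q` is an inner product on `n f = f ⊕ ⋯ ⊕ f` that is invariant under the adjoint action of the
diagonal subalgebra `{(Z, …, Z)}`. -/
structure IsInvariantMetric (Q : LinearMap.BilinForm ℝ (Fin n → f)) : Prop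
    extends IsInnerProduct Q where
  invariant : ∀ (Z : f) (x y : Fin n → f), Q ⁅diag n Z, x⁆ y + Q x ⁅diag n Z, y⁆ = 0

/-- The metric `Q` is generated by the matrix `A`: the vectors `(A i 1 X, …, A i n X)`, with
`1 ≤ i ≤ n` and `X` in a basis of `f` that is orthonormal for minus the Killing form, are
`Q`-orthonormal. -/
def IsGeneratedBy (A : Matrix (Fin n) (Fin n) ℝ) (Q : LinearMap.BilinForm ℝ (Fin n → f)) : Prop :=
  ∀ (i k : Fin n) (X Y : f),
    Q (fun j => A i j • X) (fun j => A k j • Y) = if i = k then -killingForm ℝ f X Y else 0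

variable [FiniteDimensional ℝ f]

variable (f n) in
/-- The set of invariant metrics of volume one with respect to minus the Killing form. -/
def unitVolumeMetrics : Set (LinearMap.BilinForm ℝ (Fin n → f)) :=
  {Q | IsInvariantMetric Q ∧ HasUnitVolume (-killingForm ℝ (Fin n → f)) Q}

variable (f n) in
/-- The critical points of the scalar curvature function on the manifold of invariant metrics of
volume one: the scalar curvature has derivative zero along every curve in this manifold through
the given point. -/
def criticalPoints : Set (LinearMap.BilinForm ℝ (Fin n → f)) :=
  {Q | Q ∈ unitVolumeMetrics f n ∧
    ∀ γ : ℝ → LinearMap.BilinForm ℝ (Fin n → f),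
      (∀ t, γ t ∈ unitVolumeMetrics f n) → γ 0 = Q →
      (∀ x y, DifferentiableAt ℝ (fun t => γ t x y) 0) →
      HasDerivAt (fun t => scalarCurvature (γ t)) 0 0}

end Metrics

/-! ### The standard matrices -/

/-- The lower triangular matrix that represents the standard metric of `Fᵏ⁺¹ / diag F`, scaled to
have Einstein constant one. (Indices start from zero: the row `i` is the row `i + 1` of the usual
numbering, so `k - i` stands for `k - (i + 1) + 1`.) -/
def standardMatrix (k : ℕ) : Matrix (Fin k) (Fin k) ℝ :=
  Matrix.of fun i j =>
    √(4 * ((k : ℝ) + 1) / ((k : ℝ) + 3)) *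
      if j < i then 1 / √(((k : ℝ) - (i : ℕ)) * ((k : ℝ) - (i : ℕ) + 1))
      else if j = i then √(((k : ℝ) - (i : ℕ) + 1) / ((k : ℝ) - (i : ℕ)))
      else 0

/-- The block-diagonal matrix `diag (A_{k₁}, …, A_{k_l})` of standard matrices, for a decomposition
`n = k₁ + ⋯ + k_l` into positive integers. -/
def blockMatrix {n : ℕ} (c : Composition n) : Matrix (Fin n) (Fin n) ℝ :=
  Matrix.reindex c.blocksFinEquiv c.blocksFinEquiv
    (Matrix.blockDiagonal' fun i => standardMatrix (c.blocksFun i))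

/-! ### The Lie group -/

/-- A smooth real Lie group is smooth enough for its Lie algebra to be defined. -/
instance lieGroup_minSmoothness {d : ℕ} {F : Type*} [TopologicalSpace F]
    [ChartedSpace (EuclideanSpace ℝ (Fin d)) F] [Group F] [LieGroup (𝓡 d) ∞ F] :
    LieGroup (𝓡 d) (minSmoothness ℝ 3) F :=
  LieGroup.of_le (n := ∞) (by
    rw [minSmoothness_of_isRCLikeNormedField]
    exact ENat.LEInfty.out)

instance finiteDimensional_groupLieAlgebra {d : ℕ} {F : Type*} [TopologicalSpace F]
    [ChartedSpace (EuclideanSpace ℝ (Fin d)) F] [Group F] :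
    FiniteDimensional ℝ (GroupLieAlgebra (𝓡 d) F) :=
  inferInstanceAs (FiniteDimensional ℝ (EuclideanSpace ℝ (Fin d)))

section Group

/-- The model with corners of the product manifold `Fⁿ`. -/
abbrev powModel (d n : ℕ) := ModelWithCorners.pi fun _ : Fin n => 𝓡 d

variable {d : ℕ} {F : Type*} {n : ℕ} [TopologicalSpace F]
  [ChartedSpace (EuclideanSpace ℝ (Fin d)) F] [Group F]

/-- The tangent vector `v` of `Fⁿ` at `x`, moved to the identity by left translation; the result
is written in components. -/
def toIdentity (x : Fin n → F) (v : TangentSpace (powModel d n) x) :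
    Fin n → GroupLieAlgebra (𝓡 d) F :=
  fun i => mfderiv (powModel d n) (𝓡 d) (fun y : Fin n → F => (x i)⁻¹ * y i) x v

/-- The left-invariant Riemannian metric on `Fⁿ` given by `Q`, at the point `x`. -/
def riemannianMetric (Q : LinearMap.BilinForm ℝ (Fin n → GroupLieAlgebra (𝓡 d) F))
    (x : Fin n → F) (v w : TangentSpace (powModel d n) x) : ℝ :=
  Q (toIdentity x v) (toIdentity x w)

/-- The left-invariant Riemannian metrics on `Fⁿ` given by `P` and `Q` are isometric: there is a
diffeomorphism of `Fⁿ` that pulls the second one back to the first one. -/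
def AreIsometric (P Q : LinearMap.BilinForm ℝ (Fin n → GroupLieAlgebra (𝓡 d) F)) : Prop :=
  ∃ φ : Diffeomorph (powModel d n) (powModel d n) (Fin n → F) (Fin n → F) ∞,
    ∀ (x : Fin n → F) (v w : TangentSpace (powModel d n) x),
      riemannianMetric Q (φ x) (mfderiv (powModel d n) (powModel d n) φ x v)
        (mfderiv (powModel d n) (powModel d n) φ x w) = riemannianMetric P x v w

variable [LieGroup (𝓡 d) ∞ F]

/-- `Q` is a routine Einstein metric: an invariant Einstein metric that is isometric, up to
a positive multiple, to a metric generated by a block-diagonal matrix of standard matrices. -/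
structure IsRoutineEinstein (Q : LinearMap.BilinForm ℝ (Fin n → GroupLieAlgebra (𝓡 d) F)) :
    Prop where
  isInvariantMetric : IsInvariantMetric Q
  isEinstein : IsEinstein Q
  exists_isometric : ∃ (c : Composition n)
    (P : LinearMap.BilinForm ℝ (Fin n → GroupLieAlgebra (𝓡 d) F)) (r : ℝ),
    IsGeneratedBy (blockMatrix c) P ∧ 0 < r ∧ AreIsometric Q (r • P)

variable (d F n) in
/-- The number of critical points of the scalar curvature function on the invariant metrics of
volume one on `Fⁿ⁺¹ / diag F`. -/
def CPS : ℕ∞ := (criticalPoints (GroupLieAlgebra (𝓡 d) F) n).encard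

variable (d F n) in
/-- The number of those critical points that are routine Einstein metrics. -/
def REM : ℕ∞ :=
  {Q ∈ criticalPoints (GroupLieAlgebra (𝓡 d) F) n | IsRoutineEinstein Q}.encard

end Group

end LedgerObata

end

/-!
Why the bound holds. A rooted tree with root `*` and the further vertices `1, …, n` defines the
inner product `Q (x, y) = -∑ B (x_i - x_{p i}, y_i - y_{p i})` on `n f`, where `p i` is the parent
of `i` and `x_* = 0` (`treeMetric`). It is the pull-back of the Killing metric of `n f` under the
linear map `1 - P`, where `P` replaces each component by the one of the parent.

* `Q` is an invariant metric of volume one: `1 - P` commutes with the adjoint action of the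
  diagonal subalgebra, and `P` is nilpotent, so `1 - P` has determinant one.
* The map `x ↦ (x_i x_{p i}⁻¹)_i` is a diffeomorphism of `Fⁿ` which is an isometry from `Q` to the
  bi-invariant metric `-B ⊕ ⋯ ⊕ -B` (`areIsometric_treeMetric`): up to the adjoint action on each
  component its derivative is `1 - P` (`toIdentity_edgeDiv`), and the Killing form is invariant
  under the adjoint action. The bi-invariant metric is, up to the factor `4`, generated by the
  block-diagonal matrix for `n = 1 + ⋯ + 1`, which is `2 • 1` (`isGeneratedBy_ones`).
* `Q` is Einstein: since `P` is an endomorphism of the Lie algebra, the Levi-Civita connection is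
  `(1 - P) (D_x y) = [(x + P x) / 2, (1 - P) y]`, from which `Ric = Q / 4`
  (`isEinstein_pullbackMetric`). Hence `Q` is a routine Einstein metric.
* An Einstein metric on a unimodular Lie algebra is a critical point of the scalar curvature among
  the metrics of fixed volume (`hasDerivAt_scalarCurvature`): the variation `h` of the metric
  contributes `-⟨Ric, h⟩`, a multiple of the trace of `h`, which vanishes; the variation of the
  connection contributes a divergence, which vanishes because the algebra is unimodular
  (`sum_ricciVariation_eq_zero`).

All this needs that the Killing form is negative definite (`killingForm_neg`). Averaging an inner
product over the compact group gives one that is invariant under the adjoint representation, and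
differentiating the invariance at the unit makes `ad x` skew; so `B (x, x) = tr (ad x)² ≤ 0`, with
equality only for central `x`. The derivative of the adjoint representation is computed from the
definition of the bracket by left-invariant vector fields, in a chart at the unit
(`fderiv_chartAd`).

The trees that are counted have different metrics (`manyTreeMetrics_injective`). There are `n!`
trees in which every parent is the root or has a smaller label than the child, and for `n ≥ 2` one
more is added, which is needed for `n = 2`; then `(1 + √2) ^ (n - 1) ≤ n! + 1`.
-/

namespace LedgerObata

/-! ### Inner products on a finite-dimensional Lie algebra -/

section InnerProduct

variable {L : Type*} [LieRing L] [LieAlgebra ℝ L] {Q : LinearMap.BilinForm ℝ L}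

theorem IsInnerProduct.eq_of_forall (hQ : IsInnerProduct Q) {x y : L}
    (h : ∀ z, Q x z = Q y z) : x = y := by
  by_contra hne
  have := hQ.pos (x - y) (sub_ne_zero.2 hne)
  rw [map_sub Q, LinearMap.sub_apply, h, sub_self] at this
  exact this.false

variable {ι : Type*} [Fintype ι] [DecidableEq ι] {e : Module.Basis ι ℝ L}

theorem repr_eq_of_orthonormal (he : ∀ i j, Q (e i) (e j) = if i = j then 1 else 0) (x : L)
    (i : ι) : e.repr x i = Q x (e i) := by
  have : Q (∑ j, e.repr x j • e j) (e i) = e.repr x i := by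
    simp [-Module.Basis.sum_repr, map_sum, LinearMap.sum_apply, he]
  rw [← this, e.sum_repr]

theorem trace_eq_sum_of_orthonormal (he : ∀ i j, Q (e i) (e j) = if i = j then 1 else 0)
    (φ : L →ₗ[ℝ] L) : LinearMap.trace ℝ L φ = ∑ i, Q (φ (e i)) (e i) := by
  rw [LinearMap.trace_eq_matrix_trace ℝ e, Matrix.trace]
  simp [LinearMap.toMatrix_apply, repr_eq_of_orthonormal he]

/-- The contraction of a symmetric with a skew-symmetric tensor vanishes. -/
theorem sum_apply_skew_eq_zero (hQ : IsInnerProduct Q)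
    (he : ∀ i j, Q (e i) (e j) = if i = j then 1 else 0)
    {V : Type*} [AddCommGroup V] [Module ℝ V] (A : L →ₗ[ℝ] L →ₗ[ℝ] V) (hA : ∀ x y, A x y = A y x)
    {φ : L →ₗ[ℝ] L} (hφ : ∀ x y, Q (φ x) y + Q x (φ y) = 0) :
    ∑ i, A (e i) (φ (e i)) = 0 := by
  have h1 : ∀ i, A (e i) (φ (e i)) = ∑ j, Q (φ (e i)) (e j) • A (e i) (e j) := fun i => by
    conv_lhs => rw [← e.sum_repr (φ (e i))]
    simp only [repr_eq_of_orthonormal he, map_sum, map_smul]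
  have h2 : ∑ i, A (e i) (φ (e i)) = -∑ i, A (e i) (φ (e i)) := by
    conv_lhs => simp only [h1]
    rw [Finset.sum_comm, ← Finset.sum_neg_distrib]
    refine Finset.sum_congr rfl fun i _ => ?_
    rw [h1, ← Finset.sum_neg_distrib]
    refine Finset.sum_congr rfl fun j _ => ?_
    rw [hA (e j), ← neg_smul]
    congr 1
    have := hφ (e i) (e j)
    rw [hQ.symm (e i)] at this
    linarith
  have h3 : (2 : ℝ) • ∑ i, A (e i) (φ (e i)) = 0 := by
    rw [two_smul]; exact eq_neg_iff_add_eq_zero.1 h2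
  exact (smul_eq_zero.1 h3).resolve_left two_ne_zero

variable [FiniteDimensional ℝ L]

theorem IsInnerProduct.exists_orthonormal_basis (hQ : IsInnerProduct Q) :
    ∃ e : Module.Basis (Fin (Module.finrank ℝ L)) ℝ L,
      ∀ i j, Q (e i) (e j) = if i = j then 1 else 0 := by
  obtain ⟨v, hv⟩ := LinearMap.BilinForm.exists_orthogonal_basis (B := Q) ⟨fun x y => hQ.symm x y⟩
  have hpos : ∀ i, 0 < Q (v i) (v i) := fun i => hQ.pos _ (v.ne_zero i)
  refine ⟨v.isUnitSMul (w := fun i => (√(Q (v i) (v i)))⁻¹)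
    (fun i => (inv_ne_zero (Real.sqrt_pos.2 (hpos i)).ne').isUnit), fun i j => ?_⟩
  simp only [Module.Basis.isUnitSMul_apply, map_smul, LinearMap.smul_apply, smul_eq_mul]
  split_ifs with h
  · subst h
    have := Real.mul_self_sqrt (hpos i).le
    have h0 := (Real.sqrt_pos.2 (hpos i)).ne'
    field_simp
    rw [sq]; exact this.symm
  · rw [hv h]; simp

theorem IsInnerProduct.trace_eq_zero_of_skew (hQ : IsInnerProduct Q) {φ : L →ₗ[ℝ] L}
    (hφ : ∀ x y, Q (φ x) y + Q x (φ y) = 0) : LinearMap.trace ℝ L φ = 0 := by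
  obtain ⟨e, he⟩ := hQ.exists_orthonormal_basis
  rw [trace_eq_sum_of_orthonormal he]
  refine Finset.sum_eq_zero fun i _ => ?_
  have := hφ (e i) (e i)
  rw [hQ.symm (e i)] at this
  linarith

theorem gram_eq_toMatrix (Q : LinearMap.BilinForm ℝ L) :
    gram (fun x y => Q x y) = LinearMap.BilinForm.toMatrix (Module.finBasis ℝ L) Q := by
  ext i j
  simp [gram]

theorem IsInnerProduct.isUnit_det_gram (hQ : IsInnerProduct Q) :
    IsUnit (gram fun x y => Q x y).det := by
  rw [gram_eq_toMatrix, isUnit_iff_ne_zero]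
  refine LinearMap.BilinForm.nondegenerate_iff_det_ne_zero (Module.finBasis ℝ L) |>.1 ?_
  refine ⟨fun x h => ?_, fun x h => ?_⟩ <;>
  · by_contra hx
    exact (hQ.pos x hx).ne' (h x)

/-- The `Q`-trace of a bilinear form can be computed in a `Q`-orthonormal basis. -/
theorem trace_gram_inv_mul (e : Module.Basis (Fin (Module.finrank ℝ L)) ℝ L)
    (he : ∀ i j, Q (e i) (e j) = if i = j then 1 else 0) (r : LinearMap.BilinForm ℝ L) :
    ((gram fun x y => Q x y)⁻¹ * gram fun x y => r x y).trace = ∑ i, r (e i) (e i) := by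
  set b := Module.finBasis ℝ L
  have hchange : ∀ B : LinearMap.BilinForm ℝ L, gram (fun x y => B x y) =
      (e.toMatrix b).transpose * LinearMap.BilinForm.toMatrix e B * e.toMatrix b := fun B => by
    rw [gram_eq_toMatrix, LinearMap.BilinForm.toMatrix_mul_basis_toMatrix]
  have h1 : LinearMap.BilinForm.toMatrix e Q = 1 := by
    ext i j; simp [he, Matrix.one_apply]
  have hu : e.toMatrix b * b.toMatrix e = 1 := e.toMatrix_mul_toMatrix_flip b
  have hu' : b.toMatrix e * e.toMatrix b = 1 := b.toMatrix_mul_toMatrix_flip e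
  have hinv : (gram fun x y => Q x y)⁻¹ = b.toMatrix e * (b.toMatrix e).transpose := by
    refine Matrix.inv_eq_right_inv ?_
    rw [hchange Q, h1, Matrix.mul_one, Matrix.mul_assoc, ← Matrix.mul_assoc (e.toMatrix b), hu,
      Matrix.one_mul, ← Matrix.transpose_mul, hu', Matrix.transpose_one]
  rw [hinv, hchange r, Matrix.mul_assoc, ← Matrix.mul_assoc (b.toMatrix e).transpose,
    ← Matrix.mul_assoc (b.toMatrix e).transpose, ← Matrix.transpose_mul, hu, Matrix.transpose_one,
    Matrix.one_mul, Matrix.trace_mul_comm, Matrix.mul_assoc, hu, Matrix.mul_one, Matrix.trace]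
  simp

end InnerProduct

/-! ### The Levi-Civita connection -/

section LeviCivita

variable {L : Type*} [LieRing L] [LieAlgebra ℝ L] {Q : LinearMap.BilinForm ℝ L}

theorem IsLeviCivita.unique (hs : IsInnerProduct Q) {D D' : L →ₗ[ℝ] L →ₗ[ℝ] L}
    (hD : IsLeviCivita Q D) (hD' : IsLeviCivita Q D') : D = D' := by
  -- the difference of the two is symmetric in two arguments and skew in two others
  have hsym : ∀ x y, D x y - D' x y = D y x - D' y x := fun x y => by
    have h1 := hD.torsionFree x y
    have h2 := hD'.torsionFree x y
    rw [← h2] at h1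
    rw [sub_eq_sub_iff_add_eq_add] at h1 ⊢
    rw [h1]; abel
  have hskew : ∀ x y z, Q (D x y - D' x y) z = -Q (D x z - D' x z) y := fun x y z => by
    have h1 := hD.metric x y z
    have h2 := hD'.metric x y z
    rw [hs.symm y] at h1 h2
    simp only [map_sub, LinearMap.sub_apply]
    linarith
  ext x y
  rw [← sub_eq_zero]
  by_contra hne
  have h := hs.pos _ hne
  set z := D x y - D' x y with hz
  have : Q (D x y - D' x y) z = -Q (D x y - D' x y) z := by
    calc Q (D x y - D' x y) z = -Q (D x z - D' x z) y := hskew _ _ _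
      _ = -Q (D z x - D' z x) y := by rw [hsym x z]
      _ = Q (D z y - D' z y) x := by rw [hskew z x y, neg_neg]
      _ = Q (D y z - D' y z) x := by rw [hsym z y]
      _ = -Q (D y x - D' y x) z := hskew _ _ _
      _ = -Q (D x y - D' x y) z := by rw [hsym y x]
  rw [← hz] at this
  linarith

theorem leviCivita_eq (hs : IsInnerProduct Q) {D : L →ₗ[ℝ] L →ₗ[ℝ] L}
    (hD : IsLeviCivita Q D) : leviCivita Q = D := by
  have h : ∃ D, IsLeviCivita Q D := ⟨D, hD⟩
  rw [leviCivita, dif_pos h]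
  exact h.choose_spec.unique hs hD

theorem curvature_apply (Q : LinearMap.BilinForm ℝ L) (x y z : L) :
    curvature Q y z x = leviCivita Q x (leviCivita Q y z) - leviCivita Q y (leviCivita Q x z)
      + leviCivita Q ⁅y, x⁆ z := by
  simp [curvature]

/-- The right-hand side of the Koszul formula `2 Q(D_x y, z) = …`. -/
def koszul (z : L) : LinearMap.BilinForm ℝ L →ₗ[ℝ] LinearMap.BilinForm ℝ L where
  toFun Q := LinearMap.mk₂ ℝ (fun x y => Q ⁅x, y⁆ z - Q ⁅y, z⁆ x + Q ⁅z, x⁆ y)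
    (by intros; simp only [add_lie, lie_add, map_add, LinearMap.add_apply]; ring)
    (by intros; simp only [smul_lie, lie_smul, map_smul, LinearMap.smul_apply, smul_eq_mul]; ring)
    (by intros; simp only [add_lie, lie_add, map_add, LinearMap.add_apply]; ring)
    (by intros; simp only [smul_lie, lie_smul, map_smul, LinearMap.smul_apply, smul_eq_mul]; ring)
  map_add' P Q := by ext x y; simp only [LinearMap.mk₂_apply, LinearMap.add_apply]; ring
  map_smul' c Q := by
    ext x y; simp only [LinearMap.mk₂_apply, LinearMap.smul_apply, smul_eq_mul, RingHom.id_apply]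
    ring

theorem koszul_apply (z : L) (Q : LinearMap.BilinForm ℝ L) (x y : L) :
    koszul z Q x y = Q ⁅x, y⁆ z - Q ⁅y, z⁆ x + Q ⁅z, x⁆ y := rfl

variable [FiniteDimensional ℝ L]

/-- The Koszul formula, solved for the connection with the help of a matrix `M` that stands for
the inverse of the Gram matrix; bilinear in `M` and `Q`. -/
noncomputable def koszulConnection :
    Matrix (Fin (Module.finrank ℝ L)) (Fin (Module.finrank ℝ L)) ℝ →ₗ[ℝ]
      LinearMap.BilinForm ℝ L →ₗ[ℝ] L →ₗ[ℝ] L →ₗ[ℝ] L :=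
  LinearMap.mk₂ ℝ (fun M Q => ∑ i, ∑ j, (M i j / 2) •
      (koszul (Module.finBasis ℝ L i) Q).compr₂ (LinearMap.toSpanSingleton ℝ L
        (Module.finBasis ℝ L j)))
    (by
      intros; simp only [Matrix.add_apply, add_div, add_smul, Finset.sum_add_distrib])
    (by
      intros; simp only [Matrix.smul_apply, Finset.smul_sum, smul_smul, smul_eq_mul, mul_div_assoc])
    (by
      intro M P Q
      simp only [← Finset.sum_add_distrib, ← smul_add]
      refine Finset.sum_congr rfl fun i _ => Finset.sum_congr rfl fun j _ => ?_
      congr 1; ext x y; simp [add_smul])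
    (by
      intro c M Q
      simp only [Finset.smul_sum]
      refine Finset.sum_congr rfl fun i _ => Finset.sum_congr rfl fun j _ => ?_
      rw [smul_comm]
      congr 1; ext x y; simp [smul_smul])

theorem koszulConnection_apply
    (M : Matrix (Fin (Module.finrank ℝ L)) (Fin (Module.finrank ℝ L)) ℝ)
    (Q : LinearMap.BilinForm ℝ L) (x y : L) :
    koszulConnection M Q x y = ∑ i, ∑ j, (M i j / 2) •
      koszul (Module.finBasis ℝ L i) Q x y • Module.finBasis ℝ L j := by
  simp [koszulConnection, LinearMap.sum_apply]

theorem koszul_formula (hQ : IsInnerProduct Q) (x y z : L) :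
    2 * Q (koszulConnection (gram fun x y => Q x y)⁻¹ Q x y) z = koszul z Q x y := by
  let K : L →ₗ[ℝ] ℝ := Q ⁅x, y⁆ - (Q.flip x).comp (LieAlgebra.ad ℝ L y : L →ₗ[ℝ] L)
    - (Q.flip y).comp (LieAlgebra.ad ℝ L x : L →ₗ[ℝ] L)
  have hK : ∀ z, koszul z Q x y = K z := fun z => by
    simp only [koszul_apply, K, LinearMap.sub_apply, LinearMap.comp_apply, LieAlgebra.ad_apply]
    rw [← lie_skew x z, map_neg]
    change _ = Q ⁅x, y⁆ z - Q ⁅y, z⁆ x - -(Q ⁅z, x⁆ y)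
    ring
  have : (2 : ℝ) • Q (koszulConnection (gram fun x y => Q x y)⁻¹ Q x y) = K := by
    refine (Module.finBasis ℝ L).ext fun k => ?_
    rw [koszulConnection_apply]
    simp only [map_sum, LinearMap.sum_apply, map_smul, LinearMap.smul_apply, smul_eq_mul, hK]
    set g := gram fun x y => Q x y with hg
    have h1 : ∀ i j, Q (Module.finBasis ℝ L i) (Module.finBasis ℝ L j) = g i j := fun _ _ => rfl
    have h2 : g⁻¹ * g = 1 := Matrix.nonsing_inv_mul _ hQ.isUnit_det_gram
    calc 2 * ∑ i, ∑ j, g⁻¹ i j / 2 * (K (Module.finBasis ℝ L i)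
          * Q (Module.finBasis ℝ L j) (Module.finBasis ℝ L k))
        = ∑ i, K (Module.finBasis ℝ L i) * (g⁻¹ * g) i k := by
          simp only [Matrix.mul_apply, Finset.mul_sum, h1]
          refine Finset.sum_congr rfl fun i _ => Finset.sum_congr rfl fun j _ => ?_
          ring
      _ = K (Module.finBasis ℝ L k) := by simp [h2, Matrix.one_apply]
  rw [hK, ← this]; simp

theorem IsInnerProduct.isLeviCivita (hQ : IsInnerProduct Q) :
    IsLeviCivita Q (koszulConnection (gram fun x y => Q x y)⁻¹ Q) where
  torsionFree x y := by
    refine hQ.eq_of_forall fun z => ?_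
    have h1 := koszul_formula hQ x y z
    have h2 := koszul_formula hQ y x z
    rw [koszul_apply] at h1 h2
    rw [map_sub, LinearMap.sub_apply]
    rw [← lie_skew y x, ← lie_skew x z, ← lie_skew z y] at h2
    simp only [map_neg, LinearMap.neg_apply] at h2
    linarith
  metric x y z := by
    have h1 := koszul_formula hQ x y z
    have h2 := koszul_formula hQ x z y
    rw [koszul_apply] at h1 h2
    rw [hQ.symm y]
    rw [← lie_skew x z, ← lie_skew z y, ← lie_skew y x] at h2
    simp only [map_neg, LinearMap.neg_apply] at h2
    linarith

theorem leviCivita_eq_koszulConnection (hQ : IsInnerProduct Q) :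
    leviCivita Q = koszulConnection (gram fun x y => Q x y)⁻¹ Q :=
  leviCivita_eq hQ hQ.isLeviCivita

theorem IsInnerProduct.isLeviCivita_leviCivita (hQ : IsInnerProduct Q) :
    IsLeviCivita Q (leviCivita Q) :=
  leviCivita_eq_koszulConnection hQ ▸ hQ.isLeviCivita

end LeviCivita

/-! ### Derivatives of curves in finite-dimensional vector spaces without a norm -/

section CoordDeriv

variable {U V W : Type*} [AddCommGroup U] [Module ℝ U] [AddCommGroup V] [Module ℝ V]
  [AddCommGroup W] [Module ℝ W]

/-- The curve `u` in a real vector space has the derivative `u'` at time zero, in the sense that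
this is so after applying any linear functional. -/
def HasCoordDeriv (u : ℝ → V) (u' : V) : Prop :=
  ∀ ℓ : V →ₗ[ℝ] ℝ, HasDerivAt (fun t => ℓ (u t)) (ℓ u') 0

theorem HasCoordDeriv.sub_const {u : ℝ → V} {u' : V} (h : HasCoordDeriv u u') (v : V) :
    HasCoordDeriv (fun t => u t - v) u' := fun ℓ => by
  simpa only [map_sub] using (h ℓ).sub_const (ℓ v)

theorem hasCoordDeriv_of_basis {ι : Type*} [Finite ι] (b : Module.Basis ι ℝ V) {u : ℝ → V} {u' : V}
    (h : ∀ i, HasDerivAt (fun t => b.repr (u t) i) (b.repr u' i) 0) : HasCoordDeriv u u' := by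
  have := Fintype.ofFinite ι
  intro ℓ
  have key : ∀ v, ℓ v = ∑ i, b.repr v i * ℓ (b i) := fun v => by
    conv_lhs => rw [← b.sum_repr v]
    simp only [map_sum, map_smul, smul_eq_mul]
  rw [key u', funext fun t => key (u t)]
  exact HasDerivAt.fun_sum fun i _ => (h i).mul_const _

/-- The product rule. -/
theorem HasCoordDeriv.bilin [FiniteDimensional ℝ U] [FiniteDimensional ℝ V]
    (q : U →ₗ[ℝ] V →ₗ[ℝ] W) {u : ℝ → U} {u' : U} {v : ℝ → V} {v' : V}
    (hu : HasCoordDeriv u u') (hv : HasCoordDeriv v v') :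
    HasCoordDeriv (fun t => q (u t) (v t)) (q u' (v 0) + q (u 0) v') := by
  intro ℓ
  let b := Module.finBasis ℝ U
  let c := Module.finBasis ℝ V
  have key : ∀ x y, ℓ (q x y) = ∑ i, ∑ j, b.coord i x * c.coord j y * ℓ (q (b i) (c j)) :=
    fun x y => by
      conv_lhs => rw [← b.sum_repr x, ← c.sum_repr y]
      simp only [map_sum, LinearMap.sum_apply, map_smul, LinearMap.smul_apply, smul_eq_mul,
        Finset.mul_sum, Module.Basis.coord_apply]
      exact (Finset.sum_comm).trans (Finset.sum_congr rfl fun _ _ =>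
        Finset.sum_congr rfl fun _ _ => by ring)
  rw [map_add, key u', key (u 0), funext fun t => key (u t) (v t), ← Finset.sum_add_distrib]
  simp only [← Finset.sum_add_distrib]
  refine HasDerivAt.fun_sum fun i _ => HasDerivAt.fun_sum fun j _ => ?_
  rw [← add_mul]
  exact ((hu _).fun_mul (hv _)).mul_const _

theorem hasCoordDeriv_matrix {ι κ : Type*} [Fintype ι] [Fintype κ]
    {M : ℝ → Matrix ι κ ℝ} {M' : Matrix ι κ ℝ}
    (h : ∀ i j, HasDerivAt (fun t => M t i j) (M' i j) 0) : HasCoordDeriv M M' := by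
  classical
  refine hasCoordDeriv_of_basis (Matrix.stdBasis ℝ ι κ) fun ij => ?_
  simpa [Matrix.stdBasis] using h ij.1 ij.2

end CoordDeriv

section Determinant

variable {ι : Type*} [Fintype ι] [DecidableEq ι]

theorem differentiableAt_det {M : ℝ → Matrix ι ι ℝ}
    (h : ∀ i j, DifferentiableAt ℝ (fun t => M t i j) 0) :
    DifferentiableAt ℝ (fun t => (M t).det) 0 := by
  simp only [Matrix.det_apply]
  exact DifferentiableAt.fun_sum fun σ _ =>
    (DifferentiableAt.fun_finsetProd fun i _ => h _ _).const_smul (Equiv.Perm.sign σ : ℤ)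

theorem differentiableAt_inv {M : ℝ → Matrix ι ι ℝ} {c : ℝ} (hc : ∀ t, (M t).det = c)
    (h : ∀ i j, DifferentiableAt ℝ (fun t => M t i j) 0) (i j : ι) :
    DifferentiableAt ℝ (fun t => (M t)⁻¹ i j) 0 := by
  simp only [Matrix.inv_def, hc, Matrix.smul_apply, Matrix.adjugate_apply]
  simp only [smul_eq_mul]
  refine (differentiableAt_det (M := fun t => (M t).updateRow j (Pi.single i 1))
    fun k l => ?_).const_mul _
  by_cases hk : k = j
  · subst hk; simp
  · simpa [Matrix.updateRow_ne hk] using h k l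

/-- Jacobi's formula at the identity matrix. -/
theorem hasDerivAt_det_of_eq_one {M : ℝ → Matrix ι ι ℝ} {M' : Matrix ι ι ℝ} (h1 : M 0 = 1)
    (h : ∀ i j, HasDerivAt (fun t => M t i j) (M' i j) 0) :
    HasDerivAt (fun t => (M t).det) M'.trace 0 := by
  simp only [Matrix.det_apply]
  have h2 : ∀ σ : Equiv.Perm ι, HasDerivAt (fun t => Equiv.Perm.sign σ • ∏ i, M t (σ i) i)
      (Equiv.Perm.sign σ • ∑ i, (∏ j ∈ Finset.univ.erase i, M 0 (σ j) j) • M' (σ i) i) 0 :=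
    fun σ => (HasDerivAt.fun_finsetProd fun i _ => h (σ i) i).const_smul (Equiv.Perm.sign σ : ℤ)
  have h3 := HasDerivAt.fun_sum fun σ (_ : σ ∈ Finset.univ) => h2 σ
  suffices h4 : ∑ σ : Equiv.Perm ι, Equiv.Perm.sign σ •
      ∑ i, (∏ j ∈ Finset.univ.erase i, M 0 (σ j) j) • M' (σ i) i = M'.trace by rwa [h4] at h3
  rw [Finset.sum_eq_single 1]
  · simp [h1, Matrix.trace]
  · intro σ _ hσ
    rw [Finset.sum_eq_zero, smul_zero]
    intro i _
    -- a nontrivial permutation moves some point other than `i`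
    obtain ⟨j, hji, hj⟩ : ∃ j, j ≠ i ∧ σ j ≠ j := by
      by_contra! hall
      refine hσ (Equiv.ext fun k => ?_)
      by_cases hk : k = i
      · subst hk
        by_contra hne
        exact hne (σ.injective (hall _ hne))
      · exact hall k hk
    rw [Finset.prod_eq_zero (Finset.mem_erase.2 ⟨hji, Finset.mem_univ j⟩) (by
      rw [h1, Matrix.one_apply_ne hj]), zero_smul]
  · simp

end Determinant

/-! ### The first variation of the scalar curvature -/

section Variation

variable {L : Type*} [LieRing L] [LieAlgebra ℝ L]

theorem linearMap_flip_add (D D' : L →ₗ[ℝ] L →ₗ[ℝ] L) :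
    (D + D').flip = D.flip + D'.flip := rfl

theorem linearMap_flip_smul (c : ℝ) (D : L →ₗ[ℝ] L →ₗ[ℝ] L) :
    (c • D).flip = c • D.flip := rfl

/-- The part of the Ricci curvature that is quadratic in the connection, polarized. -/
noncomputable def ricciQuad :
    (L →ₗ[ℝ] L →ₗ[ℝ] L) →ₗ[ℝ] (L →ₗ[ℝ] L →ₗ[ℝ] L) →ₗ[ℝ] LinearMap.BilinForm ℝ L :=
  LinearMap.mk₂ ℝ (fun D D' => LinearMap.mk₂ ℝ
      (fun y z => LinearMap.trace ℝ L (D.flip (D' y z) - D y ∘ₗ D'.flip z))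
      (by intros; simp only [map_add, LinearMap.add_apply, LinearMap.add_comp, map_sub]; ring)
      (by intros; simp only [map_smul, LinearMap.smul_apply, LinearMap.smul_comp, map_sub,
            smul_eq_mul]; ring)
      (by intros; simp only [map_add, LinearMap.comp_add, map_sub]; ring)
      (by intros; simp only [map_smul, LinearMap.comp_smul, map_sub, smul_eq_mul]; ring))
    (by
      intros; ext y z
      simp only [LinearMap.mk₂_apply, LinearMap.add_apply, linearMap_flip_add, LinearMap.add_comp,
        map_add, map_sub]
      ring)
    (by
      intros; ext y z
      simp only [LinearMap.mk₂_apply, LinearMap.smul_apply, linearMap_flip_smul,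
        LinearMap.smul_comp, map_smul, map_sub, smul_eq_mul]
      ring)
    (by
      intros; ext y z
      simp only [LinearMap.mk₂_apply, LinearMap.add_apply, linearMap_flip_add, LinearMap.comp_add,
        map_add, map_sub]
      ring)
    (by
      intros; ext y z
      simp only [LinearMap.mk₂_apply, LinearMap.smul_apply, linearMap_flip_smul,
        LinearMap.comp_smul, map_smul, map_sub, smul_eq_mul]
      ring)

theorem ricciQuad_apply (D D' : L →ₗ[ℝ] L →ₗ[ℝ] L) (y z : L) :
    ricciQuad D D' y z = LinearMap.trace ℝ L (D.flip (D' y z) - D y ∘ₗ D'.flip z) := rfl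

/-- The part of the Ricci curvature that is linear in the connection. -/
noncomputable def ricciBracket : (L →ₗ[ℝ] L →ₗ[ℝ] L) →ₗ[ℝ] LinearMap.BilinForm ℝ L where
  toFun D := LinearMap.mk₂ ℝ
      (fun y z => LinearMap.trace ℝ L (D.flip z ∘ₗ (LieAlgebra.ad ℝ L y : L →ₗ[ℝ] L)))
      (by intros; simp only [map_add, LinearMap.comp_add])
      (by intros; simp only [map_smul, LinearMap.comp_smul])
      (by intros; simp only [map_add, LinearMap.add_comp])
      (by intros; simp only [map_smul, LinearMap.smul_comp])
  map_add' D D' := by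
    ext y z
    simp only [LinearMap.mk₂_apply, LinearMap.add_apply, linearMap_flip_add, LinearMap.add_comp,
      map_add]
  map_smul' c D := by
    ext y z
    simp only [LinearMap.mk₂_apply, LinearMap.smul_apply, linearMap_flip_smul,
      LinearMap.smul_comp, map_smul, RingHom.id_apply]

theorem ricciBracket_apply (D : L →ₗ[ℝ] L →ₗ[ℝ] L) (y z : L) :
    ricciBracket D y z =
      LinearMap.trace ℝ L (D.flip z ∘ₗ (LieAlgebra.ad ℝ L y : L →ₗ[ℝ] L)) := rfl

theorem ricci_eq (Q : LinearMap.BilinForm ℝ L) (y z : L) :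
    ricci Q y z = (ricciQuad (leviCivita Q) (leviCivita Q) + ricciBracket (leviCivita Q)) y z := by
  simp only [ricci, curvature, map_add, LinearMap.add_apply, ricciQuad_apply, ricciBracket_apply]

/-- The derivative of the Ricci curvature in the direction of a variation of the connection. -/
noncomputable def ricciVariation (D : L →ₗ[ℝ] L →ₗ[ℝ] L) :
    (L →ₗ[ℝ] L →ₗ[ℝ] L) →ₗ[ℝ] LinearMap.BilinForm ℝ L :=
  ricciQuad D + ricciQuad.flip D + ricciBracket

variable [FiniteDimensional ℝ L] {Q : LinearMap.BilinForm ℝ L}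

/-- On a unimodular Lie algebra the metric trace of the variation of the Ricci curvature, which is
a divergence, vanishes. -/
theorem sum_ricciVariation_eq_zero (hQ : IsInnerProduct Q)
    (hL : ∀ x : L, LinearMap.trace ℝ L (LieAlgebra.ad ℝ L x) = 0)
    {ι : Type*} [Fintype ι] [DecidableEq ι] {e : Module.Basis ι ℝ L}
    (he : ∀ i j, Q (e i) (e j) = if i = j then 1 else 0)
    {D : L →ₗ[ℝ] L →ₗ[ℝ] L} (hD : IsLeviCivita Q D)
    (A : L →ₗ[ℝ] L →ₗ[ℝ] L) (hA : ∀ x y, A x y = A y x) :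
    ∑ i, ricciVariation D A (e i) (e i) = 0 := by
  have hflip : A.flip = A := by ext x y; exact hA y x
  have htD : ∀ x, LinearMap.trace ℝ L (D x) = 0 := fun x =>
    hQ.trace_eq_zero_of_skew fun y z => hD.metric x y z
  have hDflip : ∀ z, D.flip z = D z - (LieAlgebra.ad ℝ L z : L →ₗ[ℝ] L) := fun z => by
    ext x
    simp only [LinearMap.flip_apply, LinearMap.sub_apply, LieAlgebra.ad_apply]
    rw [← hD.torsionFree z x]; abel
  -- the trace of `x ↦ D_x W` is the divergence of `W`
  have h1 : ∀ z, LinearMap.trace ℝ L (D.flip z) = 0 := fun z => by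
    rw [hDflip, map_sub, htD, hL, sub_zero]
  -- the sum of the `D_{e_i} e_i` vanishes
  have h2 : ∑ i, D (e i) (e i) = 0 := by
    refine hQ.eq_of_forall fun w => ?_
    rw [map_sum, LinearMap.sum_apply, map_zero, LinearMap.zero_apply]
    have := trace_eq_sum_of_orthonormal he (D.flip w)
    rw [h1] at this
    rw [← neg_eq_zero, ← Finset.sum_neg_distrib, this]
    refine Finset.sum_congr rfl fun i _ => ?_
    have := hD.metric (e i) (e i) w
    rw [hQ.symm (D.flip w (e i))]
    simp only [LinearMap.flip_apply]
    linarith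
  -- a symmetric tensor is contracted with a skew one
  have h3 : ∀ x, ∑ i, A (e i) (D x (e i)) = 0 := fun x =>
    sum_apply_skew_eq_zero hQ he A hA fun y z => hD.metric x y z
  have key : ∀ i, ricciVariation D A (e i) (e i) = LinearMap.trace ℝ L (A (D (e i) (e i)))
      - 2 * LinearMap.trace ℝ L (A (e i) ∘ₗ D.flip (e i)) := fun i => by
    have hbr : A.flip (e i) ∘ₗ (LieAlgebra.ad ℝ L (e i) : L →ₗ[ℝ] L)
        = A (e i) ∘ₗ D (e i) - A (e i) ∘ₗ D.flip (e i) := by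
      rw [hDflip, hflip, ← LinearMap.comp_sub, sub_sub_cancel]
    simp only [ricciVariation, LinearMap.add_apply, ricciQuad_apply, ricciBracket_apply,
      LinearMap.flip_apply ricciQuad, hbr, map_sub]
    rw [h1, hflip]
    rw [LinearMap.trace_comp_comm' (D (e i)) (A (e i))]
    ring
  simp only [key]
  rw [Finset.sum_sub_distrib, ← map_sum, ← map_sum, h2, ← Finset.mul_sum, ← map_sum]
  have h4 : ∑ i, A (e i) ∘ₗ D.flip (e i) = 0 := by
    ext x
    simpa [LinearMap.sum_apply] using h3 x
  rw [h4]; simp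

/-- The trace of the product of a matrix with a Gram matrix, as a bilinear function. -/
noncomputable def gramTrace :
    Matrix (Fin (Module.finrank ℝ L)) (Fin (Module.finrank ℝ L)) ℝ →ₗ[ℝ]
      LinearMap.BilinForm ℝ L →ₗ[ℝ] ℝ :=
  LinearMap.mk₂ ℝ (fun M r => (M * gram fun x y => r x y).trace)
    (by intros; rw [Matrix.add_mul, Matrix.trace_add])
    (by intros; rw [Matrix.smul_mul, Matrix.trace_smul])
    (by
      intros; rw [← Matrix.trace_add, ← Matrix.mul_add]; rfl)
    (by
      intros; rw [← Matrix.trace_smul, ← Matrix.mul_smul]; rfl)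

theorem gramTrace_apply (M : Matrix (Fin (Module.finrank ℝ L)) (Fin (Module.finrank ℝ L)) ℝ)
    (r : LinearMap.BilinForm ℝ L) : gramTrace M r = (M * gram fun x y => r x y).trace := rfl

/-- Along a curve of inner products with the same volume, the scalar curvature of a unimodular Lie
group has derivative zero at an Einstein metric. -/
theorem hasDerivAt_scalarCurvature
    (hL : ∀ x : L, LinearMap.trace ℝ L (LieAlgebra.ad ℝ L x) = 0)
    {γ : ℝ → LinearMap.BilinForm ℝ L} (hγ : ∀ t, IsInnerProduct (γ t))
    {v : ℝ} (hvol : ∀ t, (gram fun x y => γ t x y).det = v)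
    (hdiff : ∀ x y, DifferentiableAt ℝ (fun t => γ t x y) 0) (hE : IsEinstein (γ 0)) :
    HasDerivAt (fun t => scalarCurvature (γ t)) 0 0 := by
  obtain ⟨c, hc⟩ := hE
  set g : ℝ → Matrix (Fin (Module.finrank ℝ L)) (Fin (Module.finrank ℝ L)) ℝ :=
    fun t => gram fun x y => γ t x y with hg
  have hgu : ∀ t, IsUnit (g t).det := fun t => (hγ t).isUnit_det_gram
  have hginv := differentiableAt_inv (M := g) hvol fun i j => hdiff _ _
  obtain ⟨N', hN'⟩ : ∃ N', HasCoordDeriv (fun t => (g t)⁻¹) N' :=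
    ⟨Matrix.of fun i j => deriv (fun t => (g t)⁻¹ i j) 0, hasCoordDeriv_matrix fun i j =>
      (hginv i j).hasDerivAt⟩
  obtain ⟨γ', hγ'⟩ : ∃ γ', HasCoordDeriv γ γ' := by
    let b := Module.finBasis ℝ L
    let B := (LinearMap.BilinForm.toMatrix b).symm
    have h1 : HasCoordDeriv g (Matrix.of fun i j => deriv (fun t => g t i j) 0) :=
      hasCoordDeriv_matrix fun i j => (hdiff _ _).hasDerivAt
    refine ⟨B (Matrix.of fun i j => deriv (fun t => g t i j) 0), fun ℓ => ?_⟩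
    have h2 : ∀ t, γ t = B (g t) := fun t => by
      simp only [hg, gram_eq_toMatrix, B]
      exact (LinearEquiv.symm_apply_apply _ _).symm
    simp only [h2]
    exact h1 (ℓ ∘ₗ B.toLinearMap)
  -- the difference of the connections
  set D := leviCivita (γ 0) with hDdef
  set A : ℝ → L →ₗ[ℝ] L →ₗ[ℝ] L := fun t => leviCivita (γ t) - D with hAdef
  have hA0 : A 0 = 0 := sub_self _
  have hAsym : ∀ t x y, A t x y = A t y x := fun t x y => by
    have h1 := (hγ t).isLeviCivita_leviCivita.torsionFree x y
    have h2 := (hγ 0).isLeviCivita_leviCivita.torsionFree x y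
    rw [← h2, sub_eq_sub_iff_add_eq_add] at h1
    simp only [hAdef, LinearMap.sub_apply]
    rw [sub_eq_sub_iff_add_eq_add, h1]; exact add_comm _ _
  obtain ⟨A', hA'⟩ : ∃ A', HasCoordDeriv A A' := by
    have h1 := hN'.bilin koszulConnection hγ'
    simp only [hg, ← fun t => leviCivita_eq_koszulConnection (hγ t)] at h1
    exact ⟨_, h1.sub_const D⟩
  have hvar : ∀ t, gramTrace (g 0)⁻¹ (ricciVariation D (A t)) = 0 := fun t => by
    obtain ⟨e, he⟩ := (hγ 0).exists_orthonormal_basis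
    rw [gramTrace_apply, trace_gram_inv_mul e he]
    exact sum_ricciVariation_eq_zero (hγ 0) hL he (hγ 0).isLeviCivita_leviCivita _ (hAsym t)
  -- the Ricci curvature expanded around the connection at time zero, using the Einstein equation;
  -- the first-order term in `A t` contributes nothing to the trace with respect to `g 0`
  have hscal : ∀ t, scalarCurvature (γ t) = c * ((g t)⁻¹ * g 0).trace
      + gramTrace ((g t)⁻¹ - (g 0)⁻¹) (ricciVariation D (A t))
      + gramTrace (g t)⁻¹ (ricciQuad (A t) (A t)) := fun t => by
    have h1 : (gram (ricci (γ t))) = gram fun x y => (c • γ 0 + ricciVariation D (A t)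
        + ricciQuad (A t) (A t)) x y := by
      congr 1
      funext y z
      have h0 := hc y z
      rw [ricci_eq] at h0 ⊢
      have hD : leviCivita (γ t) = D + A t := by simp [hAdef]
      rw [hD]
      rw [← hDdef] at h0
      simp only [ricciVariation, map_add, LinearMap.add_apply, LinearMap.smul_apply, smul_eq_mul,
        LinearMap.flip_apply] at h0 ⊢
      rw [← h0]; ring
    rw [scalarCurvature, h1, ← gramTrace_apply, map_add, map_add, map_sub gramTrace,
      LinearMap.sub_apply, hvar, sub_zero, map_smul, smul_eq_mul, gramTrace_apply _ (γ 0)]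
  simp only [hscal]
  have hK0 : (g 0)⁻¹ * g 0 = 1 := Matrix.nonsing_inv_mul _ (hgu 0)
  -- the trace of the variation of the metric vanishes, since the volume is constant
  have hd1 : HasDerivAt (fun t => c * ((g t)⁻¹ * g 0).trace) 0 0 := by
    have hK : ∀ i j, HasDerivAt (fun t => ((g t)⁻¹ * g 0) i j) ((N' * g 0) i j) 0 := fun i j => by
      simp only [Matrix.mul_apply]
      exact HasDerivAt.fun_sum fun k _ =>
        (hN' (LinearMap.proj k ∘ₗ LinearMap.proj i)).mul_const _
    have h1 := hasDerivAt_det_of_eq_one (M := fun t => (g t)⁻¹ * g 0) hK0 hK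
    have h2 : ∀ t, ((g t)⁻¹ * g 0).det = 1 := fun t => by
      rw [Matrix.det_mul, Matrix.det_nonsing_inv, show (g 0).det = (g t).det from
        (hvol 0).trans (hvol t).symm, Ring.inverse_mul_cancel _ (hgu t)]
    simp only [h2] at h1
    have h3 : (N' * g 0).trace = 0 := h1.unique (hasDerivAt_const _ _)
    have h4 : HasDerivAt (fun t => ((g t)⁻¹ * g 0).trace) (N' * g 0).trace 0 :=
      HasDerivAt.fun_sum fun i _ => hK i i
    rw [h3] at h4
    simpa using h4.const_mul c
  -- the remaining two terms are products of two factors that vanish at time zero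
  have hd2 : HasDerivAt (fun t => gramTrace ((g t)⁻¹ - (g 0)⁻¹) (ricciVariation D (A t))) 0 0 := by
    have := (hN'.sub_const (g 0)⁻¹).bilin (gramTrace.compl₂ (ricciVariation D)) hA'
      LinearMap.id
    simpa [hA0] using this
  have hd3 : HasDerivAt (fun t => gramTrace (g t)⁻¹ (ricciQuad (A t) (A t))) 0 0 := by
    have := hN'.bilin gramTrace (hA'.bilin (W := LinearMap.BilinForm ℝ L) ricciQuad hA')
      LinearMap.id
    simpa [hA0] using this
  exact ((hd1.fun_add hd2).fun_add hd3).congr_deriv (by simp)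

end Variation

/-! ### Pull-backs of the Killing metric by `1 - P` for an endomorphism `P` -/

section Pullback

variable {L : Type*} [LieRing L] [LieAlgebra ℝ L]

theorem killingForm_skew (x y z : L) :
    killingForm ℝ L ⁅x, y⁆ z + killingForm ℝ L y ⁅x, z⁆ = 0 := by
  rw [← lie_skew x y, map_neg, LinearMap.neg_apply, LieModule.traceForm_apply_lie_apply]
  simp

/-- The inner product `(x, y) ↦ -B (N x, N y)` for the Killing form `B`. -/
noncomputable def pullbackMetric (N : L →ₗ[ℝ] L) : LinearMap.BilinForm ℝ L :=
  (-killingForm ℝ L).compl₁₂ N N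

theorem pullbackMetric_apply (N : L →ₗ[ℝ] L) (x y : L) :
    pullbackMetric N x y = -killingForm ℝ L (N x) (N y) := rfl

theorem isInnerProduct_pullbackMetric (hK : ∀ x : L, x ≠ 0 → killingForm ℝ L x x < 0)
    {N : L →ₗ[ℝ] L} (hN : Function.Injective N) : IsInnerProduct (pullbackMetric N) where
  symm x y := by
    rw [pullbackMetric_apply, pullbackMetric_apply, LieModule.traceForm_comm]
  pos x hx := by
    rw [pullbackMetric_apply]
    exact neg_pos.2 (hK _ fun h => hx (hN (h.trans (map_zero N).symm)))

theorem isInnerProduct_neg_killingForm (hK : ∀ x : L, x ≠ 0 → killingForm ℝ L x x < 0) :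
    IsInnerProduct (-killingForm ℝ L) :=
  isInnerProduct_pullbackMetric (N := LinearMap.id) hK Function.injective_id

/-- The Levi-Civita connection of the metric `-B ((1 - P) x, (1 - P) y)` is obtained by solving
`(1 - P) (D_x y) = [(x + P x) / 2, (1 - P) y]`. -/
theorem isLeviCivita_pullbackMetric {P : L →ₗ[ℝ] L} (hP : ∀ x y, P ⁅x, y⁆ = ⁅P x, P y⁆)
    {N : L ≃ₗ[ℝ] L} (hN : ∀ x, N x = x - P x) {D : L →ₗ[ℝ] L →ₗ[ℝ] L}
    (hD : ∀ x y, N (D x y) = (1 / 2 : ℝ) • ⁅x + P x, N y⁆) :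
    IsLeviCivita (pullbackMetric N.toLinearMap) D where
  torsionFree x y := by
    apply N.injective
    rw [map_sub, hD, hD, hN, hN, hN, hP, ← smul_sub]
    simp only [lie_sub, add_lie]
    rw [← lie_skew (P y) x, ← lie_skew y x, ← lie_skew y (P x), ← lie_skew (P y) (P x)]
    module
  metric x y z := by
    simp only [pullbackMetric_apply, LinearEquiv.coe_coe, hD]
    have := killingForm_skew (x + P x) (N y) (N z)
    simp only [map_smul, LinearMap.smul_apply, smul_eq_mul]
    linarith

variable [FiniteDimensional ℝ L]

theorem trace_ad_eq_zero (hK : ∀ x : L, x ≠ 0 → killingForm ℝ L x x < 0) (x : L) :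
    LinearMap.trace ℝ L (LieAlgebra.ad ℝ L x) = 0 := by
  refine (isInnerProduct_neg_killingForm hK).trace_eq_zero_of_skew fun y z => ?_
  have := killingForm_skew x y z
  simp only [LinearMap.neg_apply, LieAlgebra.ad_apply]
  linarith

/-- The operators `R(·, y) z` are conjugate by `N = 1 - P` to `-ad (N z) ∘ ad (N y) / 4`, as for
a bi-invariant metric; the Einstein constant is `1 / 4`. -/
theorem isEinstein_pullbackMetric (hK : ∀ x : L, x ≠ 0 → killingForm ℝ L x x < 0)
    {P : L →ₗ[ℝ] L} (hP : ∀ x y, P ⁅x, y⁆ = ⁅P x, P y⁆)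
    {N : L ≃ₗ[ℝ] L} (hN : ∀ x, N x = x - P x) : IsEinstein (pullbackMetric N.toLinearMap) := by
  refine ⟨1 / 4, fun y z => ?_⟩
  let D : L →ₗ[ℝ] L →ₗ[ℝ] L := LinearMap.mk₂ ℝ
    (fun x y => N.symm ((1 / 2 : ℝ) • ⁅x + P x, N y⁆))
    (by intros; simp only [map_add, add_lie, smul_add]; abel)
    (by intro c x y; rw [map_smul P, ← smul_add, smul_lie, smul_comm, map_smul])
    (by intros; simp only [map_add, lie_add, smul_add])
    (by intro c x y; rw [map_smul N, lie_smul, smul_comm, map_smul])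
  have hD : ∀ x y, N (D x y) = (1 / 2 : ℝ) • ⁅x + P x, N y⁆ := fun x y => by simp [D]
  have hcurv : curvature (pullbackMetric N.toLinearMap) y z = N.symm.toLinearMap ∘ₗ
      ((-(1 / 4) : ℝ) • ((LieAlgebra.ad ℝ L (N z) : L →ₗ[ℝ] L)
        ∘ₗ (LieAlgebra.ad ℝ L (N y) : L →ₗ[ℝ] L))) ∘ₗ N.toLinearMap := by
    ext x
    apply N.injective
    rw [curvature_apply, leviCivita_eq (isInnerProduct_pullbackMetric hK N.injective)
      (isLeviCivita_pullbackMetric hP hN hD)]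
    simp only [LinearMap.comp_apply, LinearMap.smul_apply, LieAlgebra.ad_apply,
      LinearEquiv.coe_coe, LinearEquiv.apply_symm_apply, map_add, map_sub, hD, lie_smul]
    -- the connection acts by commutators, so that the Jacobi identity applies
    have h1 : ⁅x + P x, ⁅y + P y, N z⁆⁆ - ⁅y + P y, ⁅x + P x, N z⁆⁆
        = ⁅⁅x + P x, y + P y⁆, N z⁆ := by rw [lie_lie]
    have h2 : ⁅N z, ⁅N y, N x⁆⁆ = ⁅⁅N x, N y⁆, N z⁆ := by
      rw [← lie_skew ⁅N x, N y⁆, ← lie_skew (N y), lie_neg]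
    have h3 : ⁅⁅N x, N y⁆, N z⁆ = (2 : ℝ) • ⁅⁅x, y⁆ + ⁅P x, P y⁆, N z⁆
        - ⁅⁅x + P x, y + P y⁆, N z⁆ := by
      rw [← smul_lie, ← sub_lie, hN, hN]
      congr 1
      simp only [lie_sub, sub_lie, lie_add, add_lie]
      module
    have h4 : ⁅⁅y, x⁆ + P ⁅y, x⁆, N z⁆ = -⁅⁅x, y⁆ + ⁅P x, P y⁆, N z⁆ := by
      rw [hP, ← lie_skew y x, ← lie_skew (P y), ← neg_add, neg_lie]
    rw [h2, h3, h4, ← h1]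
    module
  rw [ricci, hcurv, ← LinearMap.comp_assoc, LinearMap.trace_comp_comm', ← LinearMap.comp_assoc]
  have : N.toLinearMap ∘ₗ N.symm.toLinearMap = LinearMap.id := by ext; simp
  rw [this, LinearMap.id_comp, map_smul, pullbackMetric_apply, LieModule.traceForm_comm]
  simp [LieModule.traceForm_apply_apply]
  rfl

theorem hasUnitVolume_pullbackMetric {N : L →ₗ[ℝ] L} (hN : LinearMap.det N = 1) :
    HasUnitVolume (-killingForm ℝ L) (pullbackMetric N) := by
  rw [HasUnitVolume, gram_eq_toMatrix, gram_eq_toMatrix, pullbackMetric]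
  have := LinearMap.BilinForm.toMatrix_comp (Module.finBasis ℝ L) (Module.finBasis ℝ L)
    (-killingForm ℝ L) N N
  rw [show (-killingForm ℝ L).compl₁₂ N N = LinearMap.BilinForm.comp (-killingForm ℝ L) N N
    from rfl, this, Matrix.det_mul, Matrix.det_mul, Matrix.det_transpose, LinearMap.det_toMatrix, hN]
  simp

end Pullback

/-! ### The metric of a rooted tree -/

section Tree

variable {n : ℕ}

/-- The function `p` describes a tree with the vertex set `Fin n` and one additional vertex, the
root: `p i = some j` means that `j` is the parent of `i`, and `p i = none` that the root is. That
there are no cycles is expressed by a rank function. -/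
def IsTree (p : Fin n → Option (Fin n)) : Prop :=
  ∃ r : Fin n → ℕ, ∀ i j, p i = some j → r j < r i

theorem isTree_of_lt {p : Fin n → Option (Fin n)} (hp : ∀ i j, p i = some j → j < i) :
    IsTree p :=
  ⟨fun i => i, hp⟩

variable {f : Type*} [LieRing f]

theorem pow_lie_apply (x y : Fin n → f) (i : Fin n) : ⁅x, y⁆ i = ⁅x i, y i⁆ := rfl

variable [LieAlgebra ℝ f]

/-- The endomorphism of `n f` that replaces each component by the one of the parent. The
component at the root is zero. -/
def parentMap (f : Type*) [LieRing f] [LieAlgebra ℝ f] (p : Fin n → Option (Fin n)) :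
    (Fin n → f) →ₗ[ℝ] (Fin n → f) where
  toFun x i := (p i).elim 0 x
  map_add' x y := by
    ext i; rcases h : p i with _ | j <;> simp [h]
  map_smul' c x := by
    ext i; rcases h : p i with _ | j <;> simp [h]

theorem parentMap_apply (p : Fin n → Option (Fin n)) (x : Fin n → f) (i : Fin n) :
    parentMap f p x i = (p i).elim 0 x := rfl

theorem parentMap_lie (p : Fin n → Option (Fin n)) (x y : Fin n → f) :
    parentMap f p ⁅x, y⁆ = ⁅parentMap f p x, parentMap f p y⁆ := by
  ext i
  rcases h : p i with _ | j <;> simp [h, parentMap_apply, pow_lie_apply]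

theorem isNilpotent_parentMap {p : Fin n → Option (Fin n)} (hp : IsTree p) :
    IsNilpotent (parentMap f p) := by
  obtain ⟨r, hr⟩ := hp
  have key : ∀ k (x : Fin n → f) i, r i < k → ((parentMap f p) ^ k) x i = 0 := by
    intro k
    induction k with
    | zero => intro x i h; omega
    | succ k ih =>
      intro x i h
      rw [pow_succ', Module.End.mul_apply, parentMap_apply]
      rcases h' : p i with _ | j
      · rfl
      · exact ih x j (by have := hr i j h'; omega)
  refine ⟨Finset.univ.sup r + 1, ?_⟩
  refine LinearMap.ext fun x => funext fun i => ?_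
  exact key _ x i (Nat.lt_succ_of_le (Finset.le_sup (Finset.mem_univ i)))

/-- The endomorphism of `n f` that subtracts from each component the one of the parent. -/
noncomputable def edgeMap {p : Fin n → Option (Fin n)} (hp : IsTree p) :
    (Fin n → f) ≃ₗ[ℝ] (Fin n → f) :=
  LinearMap.GeneralLinearGroup.generalLinearEquiv ℝ (Fin n → f)
    (isNilpotent_parentMap (f := f) hp).isUnit_one_sub.unit

theorem edgeMap_toLinearMap {p : Fin n → Option (Fin n)} (hp : IsTree p) :
    (edgeMap hp : (Fin n → f) ≃ₗ[ℝ] (Fin n → f)).toLinearMap = 1 - parentMap f p := rfl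

theorem edgeMap_apply {p : Fin n → Option (Fin n)} (hp : IsTree p) (x : Fin n → f) :
    edgeMap hp x = x - parentMap f p x := rfl

theorem edgeMap_lie_diag {p : Fin n → Option (Fin n)} (hp : IsTree p) (Z : f) (x : Fin n → f) :
    edgeMap hp ⁅diag n Z, x⁆ = ⁅diag n Z, edgeMap hp x⁆ := by
  ext i
  simp only [edgeMap_apply, Pi.sub_apply, pow_lie_apply, parentMap_apply, diag]
  rcases p i with _ | j <;> simp [pow_lie_apply, diag]

theorem edgeMap_single {p : Fin n → Option (Fin n)} (hp : IsTree p) (i k : Fin n) (X : f) :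
    edgeMap hp (Pi.single i X) k =
      ((if k = i then 1 else 0) - if p k = some i then 1 else 0 : ℝ) • X := by
  rw [edgeMap_apply, Pi.sub_apply, parentMap_apply, sub_smul]
  congr 1
  · by_cases h : k = i
    · subst h; simp
    · simp [h]
  · rcases h : p k with _ | j
    · simp
    · by_cases h' : j = i
      · subst h'; simp
      · simp [h']

variable [FiniteDimensional ℝ f]

/-- The determinant is the value of the characteristic polynomial of the nilpotent map `P`
at `1`. -/
theorem det_edgeMap {p : Fin n → Option (Fin n)} (hp : IsTree p) :
    LinearMap.det (edgeMap hp : (Fin n → f) ≃ₗ[ℝ] (Fin n → f)).toLinearMap = 1 := by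
  have h1 := (isNilpotent_parentMap (f := f) hp).charpoly_eq_X_pow_finrank
  have h2 := LinearMap.eval_charpoly (parentMap f p) 1
  rw [h1] at h2
  simpa [edgeMap_toLinearMap] using h2.symm

theorem killingForm_pow (x y : Fin n → f) :
    killingForm ℝ (Fin n → f) x y = ∑ i, killingForm ℝ f (x i) (y i) := by
  have h1 : (LieAlgebra.ad ℝ (Fin n → f) x : (Fin n → f) →ₗ[ℝ] (Fin n → f))
      ∘ₗ (LieAlgebra.ad ℝ (Fin n → f) y : (Fin n → f) →ₗ[ℝ] (Fin n → f)) =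
      ∑ i, LinearMap.single ℝ (fun _ : Fin n => f) i ∘ₗ
        ((LieAlgebra.ad ℝ f (x i) : f →ₗ[ℝ] f) ∘ₗ (LieAlgebra.ad ℝ f (y i) : f →ₗ[ℝ] f)) ∘ₗ
        LinearMap.proj i := by
    refine LinearMap.ext fun z => funext fun k => ?_
    simp [LinearMap.sum_apply, Finset.sum_apply, Pi.single_apply, pow_lie_apply]
  rw [killingForm, LieModule.traceForm_apply_apply]
  change LinearMap.trace ℝ (Fin n → f) (_ ∘ₗ _) = _
  refine (congrArg _ h1).trans ?_
  rw [map_sum]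
  refine Finset.sum_congr rfl fun i _ => ?_
  rw [LinearMap.trace_comp_comm', LinearMap.comp_assoc]
  have : LinearMap.proj i ∘ₗ LinearMap.single ℝ (fun _ : Fin n => f) i = LinearMap.id := by
    ext z; simp
  rw [this, LinearMap.comp_id, killingForm, LieModule.traceForm_apply_apply]
  rfl

theorem killingForm_pow_neg (hK : ∀ x : f, x ≠ 0 → killingForm ℝ f x x < 0) (x : Fin n → f)
    (hx : x ≠ 0) : killingForm ℝ (Fin n → f) x x < 0 := by
  obtain ⟨i, hi⟩ := Function.ne_iff.1 hx
  rw [killingForm_pow]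
  refine Finset.sum_neg' (fun j _ => ?_) ⟨i, Finset.mem_univ i, hK _ hi⟩
  rcases eq_or_ne (x j) 0 with h | h
  · simp [h]
  · exact (hK _ h).le

/-- The metric of a tree: the sum over the edges of the squared lengths of the differences. -/
noncomputable def treeMetric (f : Type*) [LieRing f] [LieAlgebra ℝ f]
    {p : Fin n → Option (Fin n)} (hp : IsTree p) : LinearMap.BilinForm ℝ (Fin n → f) :=
  pullbackMetric (edgeMap hp : (Fin n → f) ≃ₗ[ℝ] (Fin n → f)).toLinearMap

variable {p : Fin n → Option (Fin n)} (hp : IsTree p)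

theorem treeMetric_apply (x y : Fin n → f) :
    treeMetric f hp x y = ∑ i, -killingForm ℝ f (edgeMap hp x i) (edgeMap hp y i) := by
  rw [treeMetric, pullbackMetric_apply, killingForm_pow, Finset.sum_neg_distrib]
  rfl

theorem isInvariantMetric_treeMetric (hK : ∀ x : f, x ≠ 0 → killingForm ℝ f x x < 0) :
    IsInvariantMetric (treeMetric f hp) where
  toIsInnerProduct := isInnerProduct_pullbackMetric (killingForm_pow_neg hK) (edgeMap hp).injective
  invariant Z x y := by
    have := killingForm_skew (diag n Z) (edgeMap hp x) (edgeMap hp y)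
    simp only [treeMetric, pullbackMetric_apply, LinearEquiv.coe_coe, edgeMap_lie_diag]
    linarith

theorem isEinstein_treeMetric (hK : ∀ x : f, x ≠ 0 → killingForm ℝ f x x < 0) :
    IsEinstein (treeMetric f hp) :=
  isEinstein_pullbackMetric (killingForm_pow_neg hK) (parentMap_lie p) (edgeMap_apply hp)

theorem treeMetric_mem_criticalPoints (hK : ∀ x : f, x ≠ 0 → killingForm ℝ f x x < 0) :
    treeMetric f hp ∈ criticalPoints f n := by
  refine ⟨⟨isInvariantMetric_treeMetric hp hK, hasUnitVolume_pullbackMetric (det_edgeMap hp)⟩,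
    fun γ hγ h0 hdiff => ?_⟩
  exact hasDerivAt_scalarCurvature (trace_ad_eq_zero (killingForm_pow_neg hK))
    (fun t => (hγ t).1.toIsInnerProduct) (fun t => (hγ t).2) hdiff
    (h0 ▸ isEinstein_treeMetric hp hK)

/-! ### A tree can be read off from its metric -/

theorem treeMetric_single_single {i j : Fin n} (hij : i ≠ j) (X : f) :
    treeMetric f hp (Pi.single i X) (Pi.single j X) =
      ((if p i = some j then 1 else 0) + if p j = some i then 1 else 0 : ℝ) *
        killingForm ℝ f X X := by
  have h0 : ∀ k, (if p k = some i then 1 else 0 : ℝ) * (if p k = some j then 1 else 0) = 0 :=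
    fun k => by
      split_ifs with h1 h2 <;> simp
      exact hij (Option.some_injective _ (h1.symm.trans h2))
  have hi : ∀ k, (if k = i then 1 else 0 : ℝ) * (if k = j then 1 else 0) = 0 := fun k => by
    split_ifs with h1 h2 <;> simp
    exact hij (h1.symm.trans h2)
  rw [treeMetric_apply]
  simp only [edgeMap_single, map_smul, LinearMap.smul_apply, smul_eq_mul]
  have h1 : ∀ k, -(((if k = j then 1 else 0 : ℝ) - if p k = some j then 1 else 0) *
      (((if k = i then 1 else 0) - if p k = some i then 1 else 0) * killingForm ℝ f X X)) =
      ((if k = i then (if p k = some j then 1 else 0) else 0) +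
        if k = j then (if p k = some i then 1 else 0) else 0) * killingForm ℝ f X X := fun k => by
    have a := h0 k
    have b := hi k
    have c : ∀ (P : Prop) [Decidable P] (u : ℝ), (if P then u else 0) = (if P then 1 else 0) * u :=
      fun P _ u => by split_ifs <;> simp
    rw [c (k = i) (if p k = some j then 1 else 0), c (k = j) (if p k = some i then 1 else 0)]
    linear_combination (-killingForm ℝ f X X) * a - (killingForm ℝ f X X) * b
  simp only [h1, ← Finset.sum_mul, Finset.sum_add_distrib, Finset.sum_ite_eq', Finset.mem_univ,
    if_true]

theorem treeMetric_diag_single (i : Fin n) (X : f) :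
    treeMetric f hp (diag n X) (Pi.single i X) =
      (if p i = none then 1 else 0) * -killingForm ℝ f X X := by
  rw [treeMetric_apply]
  have h1 : ∀ k, edgeMap hp (diag n X) k = (if p k = none then 1 else 0 : ℝ) • X := fun k => by
    rw [edgeMap_apply, Pi.sub_apply, parentMap_apply, diag]
    rcases h : p k with _ | j <;> simp [diag]
  simp only [h1, edgeMap_single, map_smul, LinearMap.smul_apply, smul_eq_mul]
  have h2 : ∀ k, -(((if k = i then 1 else 0 : ℝ) - if p k = some i then 1 else 0) *
      ((if p k = none then 1 else 0) * killingForm ℝ f X X)) =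
      if k = i then (if p k = none then 1 else 0) * -killingForm ℝ f X X else 0 := fun k => by
    rcases h : p k with _ | j <;> split_ifs <;> simp_all
  simp only [h2, Finset.sum_ite_eq', Finset.mem_univ, if_true]

end Tree

/-! ### Derivatives of maps between manifolds, with values in the model spaces -/

section TangentDeriv

variable {E E' E'' H H' H'' M M' M'' : Type*}
  [NormedAddCommGroup E] [NormedSpace ℝ E] [TopologicalSpace H] {I : ModelWithCorners ℝ E H}
  [TopologicalSpace M] [ChartedSpace H M]
  [NormedAddCommGroup E'] [NormedSpace ℝ E'] [TopologicalSpace H'] {I' : ModelWithCorners ℝ E' H'}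
  [TopologicalSpace M'] [ChartedSpace H' M']
  [NormedAddCommGroup E''] [NormedSpace ℝ E''] [TopologicalSpace H'']
  {I'' : ModelWithCorners ℝ E'' H''} [TopologicalSpace M''] [ChartedSpace H'' M'']

variable (I I') in
/-- The derivative of a map between manifolds as a linear map between the model spaces, to which
all tangent spaces are definitionally equal. With this type the base points can be rewritten. -/
noncomputable def modelDeriv (f : M → M') (x : M) : E →L[ℝ] E' := mfderiv I I' f x

theorem modelDeriv_comp {g : M' → M''} {f : M → M'} {x : M} (hg : MDifferentiableAt I' I'' g (f x))
    (hf : MDifferentiableAt I I' f x) :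
    modelDeriv I I'' (g ∘ f) x = (modelDeriv I' I'' g (f x)).comp (modelDeriv I I' f x) :=
  mfderiv_comp x hg hf

theorem modelDeriv_id (x : M) : modelDeriv I I id x = ContinuousLinearMap.id ℝ E :=
  mfderiv_id

theorem modelDeriv_const (x : M) (y : M') : modelDeriv I I' (fun _ => y) x = 0 :=
  mfderiv_const

end TangentDeriv

/-! ### The adjoint representation of a Lie group -/

section Adjoint

open VectorField

variable {d : ℕ} {F : Type*} [TopologicalSpace F] [ChartedSpace (EuclideanSpace ℝ (Fin d)) F]
  [Group F]

/-- The adjoint representation: the derivative of the conjugation by `g` at the identity. -/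
noncomputable def Ad (g : F) : GroupLieAlgebra (𝓡 d) F →L[ℝ] GroupLieAlgebra (𝓡 d) F :=
  modelDeriv (𝓡 d) (𝓡 d) (fun h : F => g * h * g⁻¹) 1

theorem mulInvariantVectorField_eq (v : GroupLieAlgebra (𝓡 d) F) (g : F) :
    mulInvariantVectorField v g = modelDeriv (𝓡 d) (𝓡 d) (fun h : F => g * h) 1 v := rfl

variable [LieGroup (𝓡 d) ∞ F]

theorem contMDiff_conj (g : F) : ContMDiff (𝓡 d) (𝓡 d) ∞ (fun h : F => g * h * g⁻¹) :=
  (contMDiff_const.mul contMDiff_id).mul contMDiff_const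

theorem mdifferentiable_conj (g : F) :
    MDifferentiable (𝓡 d) (𝓡 d) (fun h : F => g * h * g⁻¹) :=
  (contMDiff_conj g).mdifferentiable (by simp)

theorem mdifferentiable_mul_left (g : F) :
    MDifferentiable (𝓡 d) (𝓡 d) (fun h : F => g * h) :=
  (contMDiff_mul_left (I := 𝓡 d) (n := ∞)).mdifferentiable (by simp)

theorem modelDeriv_conj_comp (g x : F) :
    (modelDeriv (𝓡 d) (𝓡 d) (fun h : F => g⁻¹ * h * g⁻¹⁻¹) (g * x * g⁻¹)).comp
      (modelDeriv (𝓡 d) (𝓡 d) (fun h : F => g * h * g⁻¹) x) = ContinuousLinearMap.id ℝ _ := by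
  rw [← modelDeriv_comp (f := fun h : F => g * h * g⁻¹) (mdifferentiable_conj (d := d) g⁻¹ _)
    (mdifferentiable_conj g x), ← modelDeriv_id (I := 𝓡 d) x]
  congr 1
  ext h
  simp [mul_assoc]

theorem Ad_apply_inv_apply (g : F) (v : GroupLieAlgebra (𝓡 d) F) : Ad g (Ad g⁻¹ v) = v := by
  have h := modelDeriv_conj_comp (d := d) g⁻¹ 1
  simp only [mul_one, inv_inv, inv_mul_cancel] at h
  simp only [Ad, inv_inv]
  exact DFunLike.congr_fun h v

theorem Ad_mul (g h : F) : Ad (d := d) (g * h) = (Ad g).comp (Ad h) := by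
  have h1 : (fun x : F => g * h * x * (g * h)⁻¹) =
      (fun x => g * x * g⁻¹) ∘ (fun x => h * x * h⁻¹) := by
    ext x; simp [mul_assoc]
  have h2 := modelDeriv_comp (f := fun x : F => h * x * h⁻¹)
    (mdifferentiable_conj (d := d) g (h * 1 * h⁻¹)) (mdifferentiable_conj h 1)
  rw [← h1, mul_one, mul_inv_cancel] at h2
  exact h2

/-- A conjugation pulls a left-invariant vector field back to a left-invariant one. -/
theorem mpullback_conj_mulInvariantVectorField (g : F) (v : GroupLieAlgebra (𝓡 d) F) :
    mpullback (𝓡 d) (𝓡 d) (fun h : F => g * h * g⁻¹) (mulInvariantVectorField v) =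
      mulInvariantVectorField (Ad g⁻¹ v) := by
  ext1 x
  have h3 : (modelDeriv (𝓡 d) (𝓡 d) (fun h : F => g * h * g⁻¹) x).inverse =
      modelDeriv (𝓡 d) (𝓡 d) (fun h : F => g⁻¹ * h * g⁻¹⁻¹) (g * x * g⁻¹) := by
    refine ContinuousLinearMap.inverse_eq ?_ (modelDeriv_conj_comp g x)
    have h2 := modelDeriv_conj_comp (d := d) g⁻¹ (g * x * g⁻¹)
    rw [show g⁻¹ * (g * x * g⁻¹) * g⁻¹⁻¹ = x by group] at h2
    simpa only [inv_inv] using h2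
  have h4 : (fun h : F => g⁻¹ * h * g⁻¹⁻¹) ∘ (fun h : F => g * x * g⁻¹ * h) =
      (fun h => x * h) ∘ (fun h : F => g⁻¹ * h * g⁻¹⁻¹) := by
    ext h; simp [mul_assoc]
  have h5 := modelDeriv_comp (f := fun h : F => g * x * g⁻¹ * h)
    (mdifferentiable_conj (d := d) g⁻¹ (g * x * g⁻¹ * 1))
    (mdifferentiable_mul_left (d := d) (g * x * g⁻¹) 1)
  have h6 := modelDeriv_comp (f := fun h : F => g⁻¹ * h * g⁻¹⁻¹)
    (mdifferentiable_mul_left (d := d) x (g⁻¹ * 1 * g⁻¹⁻¹))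
    (mdifferentiable_conj (d := d) g⁻¹ 1)
  rw [h4, h6] at h5
  simp only [mul_one, mul_inv_cancel] at h5
  change (modelDeriv (𝓡 d) (𝓡 d) (fun h : F => g * h * g⁻¹) x).inverse
    (modelDeriv (𝓡 d) (𝓡 d) (fun h : F => g * x * g⁻¹ * h) 1 v) = _
  rw [h3]
  exact (DFunLike.congr_fun h5 v).symm

theorem Ad_lie (g : F) (v w : GroupLieAlgebra (𝓡 d) F) : Ad g ⁅v, w⁆ = ⁅Ad g v, Ad g w⁆ := by
  obtain ⟨g, rfl⟩ : ∃ a, a⁻¹ = g := ⟨g⁻¹, inv_inv g⟩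
  have h1 : ∀ u : GroupLieAlgebra (𝓡 d) F, mulInvariantVectorField u (1 : F) = u := fun u => by
    have : (fun h : F => 1 * h) = id := by ext; simp
    rw [mulInvariantVectorField_eq, this, modelDeriv_id]
    rfl
  have : IsManifold (𝓡 d) (minSmoothness ℝ 3) F := inferInstance
  have : IsManifold (𝓡 d) (minSmoothness ℝ 2) F :=
    IsManifold.of_le (n := minSmoothness ℝ 3) (minSmoothness_monotone (by norm_cast))
  have h2 := mpullback_mlieBracket (I := 𝓡 d) (I' := 𝓡 d) (n := ∞) (x₀ := (1 : F))
    (f := fun h : F => g * h * g⁻¹) (V := mulInvariantVectorField v)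
    (W := mulInvariantVectorField w) (mdifferentiableAt_mulInvariantVectorField _)
    (mdifferentiableAt_mulInvariantVectorField _) (contMDiff_conj (d := d) g 1) (by
      rw [minSmoothness_of_isRCLikeNormedField]; exact ENat.LEInfty.out)
  rw [← mulInvariantVector_mlieBracket, mpullback_conj_mulInvariantVectorField,
    mpullback_conj_mulInvariantVectorField, mpullback_conj_mulInvariantVectorField, h1] at h2
  exact h2

theorem killingForm_Ad (g : F) (v w : GroupLieAlgebra (𝓡 d) F) :
    killingForm ℝ (GroupLieAlgebra (𝓡 d) F) (Ad g v) (Ad g w) =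
      killingForm ℝ (GroupLieAlgebra (𝓡 d) F) v w := by
  let e : GroupLieAlgebra (𝓡 d) F ≃ₗ⁅ℝ⁆ GroupLieAlgebra (𝓡 d) F :=
    { (Ad g).toLinearMap with
      map_lie' := fun {x y} => Ad_lie g x y
      invFun := Ad g⁻¹
      left_inv := fun x => by
        have := Ad_apply_inv_apply g⁻¹ x
        rwa [inv_inv] at this
      right_inv := Ad_apply_inv_apply g }
  exact LieAlgebra.killingForm_of_equiv_apply e v w

/-- The adjoint representation is smooth. -/
theorem contMDiff_Ad :
    ContMDiff (𝓡 d) 𝓘(ℝ, EuclideanSpace ℝ (Fin d) →L[ℝ] EuclideanSpace ℝ (Fin d)) ∞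
      (fun g : F => modelDeriv (𝓡 d) (𝓡 d) (fun h : F => g * h * g⁻¹) 1) := by
  intro g
  have hm : IsManifold (𝓡 d) ∞ F := inferInstance
  have : IsManifold (𝓡 d) 1 F := IsManifold.of_le (n := ∞) ENat.LEInfty.out
  have h1 := ContMDiffAt.mfderiv (I := 𝓡 d) (I' := 𝓡 d) (J := 𝓡 d) (n := ∞) (m := ∞) (x₀ := g)
    (fun (g h : F) => g * h * g⁻¹) (fun _ => 1)
    ((contMDiff_fst.mul contMDiff_snd).mul contMDiff_fst.inv).contMDiffAt contMDiffAt_const le_rfl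
  -- at `1`, where all base points lie, the trivialization of the tangent bundle is the identity
  have h2 : ∀ y z : F, y = 1 → z = 1 →
      (tangentBundleCore (𝓡 d) F).coordChange (achart _ y) (achart _ z) y =
        ContinuousLinearMap.id ℝ (EuclideanSpace ℝ (Fin d)) := by
    rintro _ _ rfl rfl
    ext1 v
    exact (tangentBundleCore (𝓡 d) F).coordChange_self _ _ (mem_chart_source _ _) v
  refine h1.congr_of_eventuallyEq (Filter.Eventually.of_forall fun x => ?_)
  have h3 := inTangentCoordinates_eq (I := 𝓡 d) (I' := 𝓡 d) (fun _ : F => (1 : F))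
    (fun y : F => y * 1 * y⁻¹) (fun y => modelDeriv (𝓡 d) (𝓡 d) (fun h : F => y * h * y⁻¹) 1)
    (x₀ := g) (x := x) (mem_chart_source _ _) (by simp)
  rw [h2 _ _ rfl rfl, h2 _ _ (by simp) (by simp)] at h3
  exact h3.symm

end Adjoint

/-! ### The derivative of the adjoint representation -/

section MixedDerivative

open Topology

variable {E E' : Type*} [NormedAddCommGroup E] [NormedSpace ℝ E]
  [NormedAddCommGroup E'] [NormedSpace ℝ E'] {m : E × E → E'} {a : E}

theorem eventually_fderiv_right (hm : ContDiffAt ℝ 2 m (a, a)) :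
    (fun x => fderiv ℝ (fun y => m (x, y)) a) =ᶠ[𝓝 a]
      fun x => (fderiv ℝ m (x, a)).comp (ContinuousLinearMap.inr ℝ E E) := by
  have h1 : ∀ᶠ p in 𝓝 (a, a), DifferentiableAt ℝ m p :=
    (hm.eventually (by simp)).mono fun p hp => hp.differentiableAt (by simp)
  have h2 : Filter.Tendsto (fun x : E => (x, a)) (𝓝 a) (𝓝 (a, a)) :=
    (Continuous.prodMk_left a).tendsto a
  filter_upwards [h2.eventually h1] with x hx
  exact (hx.hasFDerivAt.comp a (hasFDerivAt_prodMk_right x a)).fderiv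

theorem eventually_fderiv_left (hm : ContDiffAt ℝ 2 m (a, a)) :
    (fun x => fderiv ℝ (fun y => m (y, x)) a) =ᶠ[𝓝 a]
      fun x => (fderiv ℝ m (a, x)).comp (ContinuousLinearMap.inl ℝ E E) := by
  have h1 : ∀ᶠ p in 𝓝 (a, a), DifferentiableAt ℝ m p :=
    (hm.eventually (by simp)).mono fun p hp => hp.differentiableAt (by simp)
  have h2 : Filter.Tendsto (fun x : E => (a, x)) (𝓝 a) (𝓝 (a, a)) :=
    (Continuous.prodMk_right a).tendsto a
  filter_upwards [h2.eventually h1] with x hx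
  exact (hx.hasFDerivAt.comp a (hasFDerivAt_prodMk_left a x)).fderiv

theorem hasFDerivAt_fderiv_right (hm : ContDiffAt ℝ 2 m (a, a)) :
    HasFDerivAt (fun x => fderiv ℝ (fun y => m (x, y)) a)
      (((ContinuousLinearMap.compL ℝ E (E × E) E').flip (ContinuousLinearMap.inr ℝ E E)).comp
        ((fderiv ℝ (fderiv ℝ m) (a, a)).comp (ContinuousLinearMap.inl ℝ E E))) a := by
  have h1 : HasFDerivAt (fderiv ℝ m) (fderiv ℝ (fderiv ℝ m) (a, a)) (a, a) :=
    ((hm.fderiv_right (m := 1) (by norm_num)).differentiableAt (by simp)).hasFDerivAt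
  refine HasFDerivAt.congr_of_eventuallyEq ?_ (eventually_fderiv_right hm)
  exact ((ContinuousLinearMap.compL ℝ E (E × E) E').flip
    (ContinuousLinearMap.inr ℝ E E)).hasFDerivAt.comp a
      (HasFDerivAt.comp (f := fun x : E => (x, a)) a h1 (hasFDerivAt_prodMk_left a a))

theorem hasFDerivAt_fderiv_left (hm : ContDiffAt ℝ 2 m (a, a)) :
    HasFDerivAt (fun x => fderiv ℝ (fun y => m (y, x)) a)
      (((ContinuousLinearMap.compL ℝ E (E × E) E').flip (ContinuousLinearMap.inl ℝ E E)).comp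
        ((fderiv ℝ (fderiv ℝ m) (a, a)).comp (ContinuousLinearMap.inr ℝ E E))) a := by
  have h1 : HasFDerivAt (fderiv ℝ m) (fderiv ℝ (fderiv ℝ m) (a, a)) (a, a) :=
    ((hm.fderiv_right (m := 1) (by norm_num)).differentiableAt (by simp)).hasFDerivAt
  refine HasFDerivAt.congr_of_eventuallyEq ?_ (eventually_fderiv_left hm)
  exact ((ContinuousLinearMap.compL ℝ E (E × E) E').flip
    (ContinuousLinearMap.inl ℝ E E)).hasFDerivAt.comp a
      (HasFDerivAt.comp (f := fun x : E => (a, x)) a h1 (hasFDerivAt_prodMk_right a a))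

/-- The mixed second partial derivatives agree. -/
theorem fderiv_fderiv_left_apply (hm : ContDiffAt ℝ 2 m (a, a)) (v w : E) :
    fderiv ℝ (fun x => fderiv ℝ (fun y => m (y, x)) a) a v w =
      fderiv ℝ (fun x => fderiv ℝ (fun y => m (x, y)) a) a w v := by
  rw [(hasFDerivAt_fderiv_left hm).fderiv, (hasFDerivAt_fderiv_right hm).fderiv]
  exact (hm.isSymmSndFDerivAt (by simp)) (0, v) (w, 0)

end MixedDerivative

section AdjointDerivative

open VectorField Topology

variable {d : ℕ} (F : Type*) [TopologicalSpace F] [ChartedSpace (EuclideanSpace ℝ (Fin d)) F]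
  [Group F]

/-- The multiplication of a Lie group, read in the preferred chart at the identity. -/
noncomputable def chartMul (p : EuclideanSpace ℝ (Fin d) × EuclideanSpace ℝ (Fin d)) :
    EuclideanSpace ℝ (Fin d) :=
  extChartAt (𝓡 d) (1 : F)
    ((extChartAt (𝓡 d) (1 : F)).symm p.1 * (extChartAt (𝓡 d) (1 : F)).symm p.2)

/-- The point of the model space that corresponds to the identity. -/
noncomputable def chartOne : EuclideanSpace ℝ (Fin d) := extChartAt (𝓡 d) (1 : F) 1

variable {F}

theorem symm_chartOne : (extChartAt (𝓡 d) (1 : F)).symm (chartOne (d := d) F) = 1 :=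
  extChartAt_to_inv 1

theorem target_mem_nhds_chartOne :
    (extChartAt (𝓡 d) (1 : F)).target ∈ 𝓝 (chartOne (d := d) F) :=
  extChartAt_target_mem_nhds 1

variable (F) in
/-- The adjoint representation as a function on the model space, by means of the preferred chart
at the identity. -/
noncomputable def chartAd (a : EuclideanSpace ℝ (Fin d)) :
    EuclideanSpace ℝ (Fin d) →L[ℝ] EuclideanSpace ℝ (Fin d) :=
  modelDeriv (𝓡 d) (𝓡 d) (fun h : F => (extChartAt (𝓡 d) (1 : F)).symm a * h *
    ((extChartAt (𝓡 d) (1 : F)).symm a)⁻¹) 1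

theorem chartAd_chartOne : chartAd (d := d) F (chartOne F) = ContinuousLinearMap.id ℝ _ := by
  have : (fun h : F => 1 * h * 1⁻¹) = id := by ext; simp
  rw [chartAd, symm_chartOne, this, modelDeriv_id]

variable [LieGroup (𝓡 d) ∞ F]

theorem contMDiffAt_chart_symm {a : EuclideanSpace ℝ (Fin d)}
    (ha : a ∈ (extChartAt (𝓡 d) (1 : F)).target) :
    ContMDiffAt 𝓘(ℝ, EuclideanSpace ℝ (Fin d)) (𝓡 d) ∞ (extChartAt (𝓡 d) (1 : F)).symm a :=
  (contMDiffOn_extChartAt_symm (I := 𝓡 d) (n := ∞) (1 : F)).contMDiffAt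
    ((isOpen_extChartAt_target (I := 𝓡 d) (1 : F)).mem_nhds ha)

theorem contDiffAt_chartMul :
    ContDiffAt ℝ ∞ (chartMul (d := d) F) (chartOne F, chartOne F) := by
  rw [← contMDiffAt_iff_contDiffAt]
  have h1 : ContMDiffAt 𝓘(ℝ, EuclideanSpace ℝ (Fin d)) (𝓡 d) ∞ (extChartAt (𝓡 d) (1 : F)).symm
    (chartOne (d := d) F) := contMDiffAt_chart_symm (mem_of_mem_nhds target_mem_nhds_chartOne)
  have h2 := ContMDiffAt.comp (chartOne (d := d) F, chartOne (d := d) F) h1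
    (contDiffAt_fst (n := ∞) (𝕜 := ℝ)).contMDiffAt
  have h3 := ContMDiffAt.comp (chartOne (d := d) F, chartOne (d := d) F) h1
    (contDiffAt_snd (n := ∞) (𝕜 := ℝ)).contMDiffAt
  refine ContMDiffAt.comp_of_eq (contMDiffAt_extChartAt (x := (1 : F))) (h2.mul h3) ?_
  simp only [symm_chartOne, mul_one]

theorem mdifferentiable_mul_right (g : F) :
    MDifferentiable (𝓡 d) (𝓡 d) (fun h : F => h * g) :=
  (contMDiff_mul_right (I := 𝓡 d) (n := ∞)).mdifferentiable (by simp)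

theorem isManifold_one : IsManifold (𝓡 d) 1 F :=
  have : IsManifold (𝓡 d) ∞ F := inferInstance
  IsManifold.of_le (n := ∞) ENat.LEInfty.out

theorem modelDeriv_chart_symm_chartOne :
    modelDeriv 𝓘(ℝ, EuclideanSpace ℝ (Fin d)) (𝓡 d) (extChartAt (𝓡 d) (1 : F)).symm (chartOne F) =
      ContinuousLinearMap.id ℝ _ := by
  have := isManifold_one (d := d) (F := F)
  have h := mfderivWithin_range_extChartAt_symm (I := 𝓡 d) (x := (1 : F))
  rw [ModelWithCorners.Boundaryless.range_eq_univ, mfderivWithin_univ] at h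
  exact h

theorem modelDeriv_chart_one :
    modelDeriv (𝓡 d) 𝓘(ℝ, EuclideanSpace ℝ (Fin d)) (extChartAt (𝓡 d) (1 : F)) 1 =
      ContinuousLinearMap.id ℝ _ := by
  have := isManifold_one (d := d) (F := F)
  exact mfderiv_extChartAt_self (I := 𝓡 d) (x := (1 : F))

theorem mdifferentiableAt_chart {a : EuclideanSpace ℝ (Fin d)}
    (ha : a ∈ (extChartAt (𝓡 d) (1 : F)).target) :
    MDifferentiableAt (𝓡 d) 𝓘(ℝ, EuclideanSpace ℝ (Fin d)) (extChartAt (𝓡 d) (1 : F))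
      ((extChartAt (𝓡 d) (1 : F)).symm a) := by
  have := isManifold_one (d := d) (F := F)
  refine mdifferentiableAt_extChartAt ?_
  rw [← extChartAt_source (𝓡 d)]
  exact (extChartAt (𝓡 d) (1 : F)).map_target ha

theorem fderiv_chartMul_right {a : EuclideanSpace ℝ (Fin d)}
    (ha : a ∈ (extChartAt (𝓡 d) (1 : F)).target) :
    fderiv ℝ (fun b => chartMul F (a, b)) (chartOne F) =
      (modelDeriv (𝓡 d) 𝓘(ℝ, EuclideanSpace ℝ (Fin d)) (extChartAt (𝓡 d) (1 : F))
        ((extChartAt (𝓡 d) (1 : F)).symm a)).comp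
      (modelDeriv (𝓡 d) (𝓡 d) (fun h => (extChartAt (𝓡 d) (1 : F)).symm a * h) 1) := by
  set φ := extChartAt (𝓡 d) (1 : F)
  have hs := (contMDiffAt_chart_symm (d := d) (F := F)
    (mem_of_mem_nhds target_mem_nhds_chartOne)).mdifferentiableAt (by simp)
  have h1 := modelDeriv_comp (mdifferentiable_mul_left (d := d) (φ.symm a)
    (φ.symm (chartOne F))) hs
  have hd := (mdifferentiable_mul_left (d := d) (φ.symm a) _).comp (chartOne F) hs
  have h2 := modelDeriv_comp (I := 𝓘(ℝ, EuclideanSpace ℝ (Fin d)))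
    (I'' := 𝓘(ℝ, EuclideanSpace ℝ (Fin d))) (f := (fun h => φ.symm a * h) ∘ φ.symm)
    (x := chartOne F) (g := φ) (by
      simp only [Function.comp_apply, φ, symm_chartOne, mul_one]
      exact mdifferentiableAt_chart ha) hd
  rw [h1] at h2
  simp only [φ, Function.comp_apply, symm_chartOne, mul_one, modelDeriv_chart_symm_chartOne,
    ContinuousLinearMap.comp_id] at h2
  exact mfderiv_eq_fderiv.symm.trans h2

theorem fderiv_chartMul_left {a : EuclideanSpace ℝ (Fin d)}
    (ha : a ∈ (extChartAt (𝓡 d) (1 : F)).target) :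
    fderiv ℝ (fun b => chartMul F (b, a)) (chartOne F) =
      (modelDeriv (𝓡 d) 𝓘(ℝ, EuclideanSpace ℝ (Fin d)) (extChartAt (𝓡 d) (1 : F))
        ((extChartAt (𝓡 d) (1 : F)).symm a)).comp
      (modelDeriv (𝓡 d) (𝓡 d) (fun h => h * (extChartAt (𝓡 d) (1 : F)).symm a) 1) := by
  set φ := extChartAt (𝓡 d) (1 : F)
  have hs := (contMDiffAt_chart_symm (d := d) (F := F)
    (mem_of_mem_nhds target_mem_nhds_chartOne)).mdifferentiableAt (by simp)
  have h1 := modelDeriv_comp (mdifferentiable_mul_right (d := d) (φ.symm a)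
    (φ.symm (chartOne F))) hs
  have hd := (mdifferentiable_mul_right (d := d) (φ.symm a) _).comp (chartOne F) hs
  have h2 := modelDeriv_comp (I := 𝓘(ℝ, EuclideanSpace ℝ (Fin d)))
    (I'' := 𝓘(ℝ, EuclideanSpace ℝ (Fin d))) (f := (fun h => h * φ.symm a) ∘ φ.symm)
    (x := chartOne F) (g := φ) (by
      simp only [Function.comp_apply, φ, symm_chartOne, one_mul]
      exact mdifferentiableAt_chart ha) hd
  rw [h1] at h2
  simp only [φ, Function.comp_apply, symm_chartOne, one_mul, modelDeriv_chart_symm_chartOne,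
    ContinuousLinearMap.comp_id] at h2
  exact mfderiv_eq_fderiv.symm.trans h2

/-- The bracket of the Lie algebra, as the skew part of a second derivative of the
multiplication. -/
theorem lie_eq_fderiv_chartMul (v w : GroupLieAlgebra (𝓡 d) F) :
    ⁅v, w⁆ =
      fderiv ℝ (fun a => fderiv ℝ (fun b => chartMul F (a, b)) (chartOne F)) (chartOne F) v w -
      fderiv ℝ (fun a => fderiv ℝ (fun b => chartMul F (a, b)) (chartOne F)) (chartOne F) w v := by
  have := isManifold_one (d := d) (F := F)
  have hm : ContDiffAt ℝ 2 (chartMul (d := d) F) (chartOne F, chartOne F) :=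
    contDiffAt_chartMul.of_le ENat.LEInfty.out
  have hA := (hasFDerivAt_fderiv_right hm).differentiableAt
  -- left-invariant vector fields in the chart
  obtain ⟨V, hVdef⟩ : ∃ V : GroupLieAlgebra (𝓡 d) F → EuclideanSpace ℝ (Fin d) →
      EuclideanSpace ℝ (Fin d), ∀ u, V u =
      mpullbackWithin 𝓘(ℝ, EuclideanSpace ℝ (Fin d)) (𝓡 d) (extChartAt (𝓡 d) (1 : F)).symm
        (mulInvariantVectorField u) (Set.range (𝓡 d)) := ⟨_, fun _ => rfl⟩
  have hV : ∀ u : GroupLieAlgebra (𝓡 d) F, V u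
      =ᶠ[𝓝 (chartOne F)] fun a => fderiv ℝ (fun b => chartMul F (a, b)) (chartOne F) u := by
    intro u
    filter_upwards [target_mem_nhds_chartOne] with a ha
    rw [fderiv_chartMul_right ha]
    have h1 := mfderiv_extChartAt_comp_mfderivWithin_extChartAt_symm (I := 𝓡 d) ha
    have h2 := mfderivWithin_extChartAt_symm_comp_mfderiv_extChartAt (I := 𝓡 d) ha
    have h3 := ContinuousLinearMap.inverse_eq h2 h1
    rw [hVdef, mpullbackWithin_apply]
    exact DFunLike.congr_fun h3 _
  have hAone : ∀ u : EuclideanSpace ℝ (Fin d),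
      fderiv ℝ (fun b => chartMul F (chartOne F, b)) (chartOne F) u = u := fun u => by
    have h1 : (fun h : F => 1 * h) = id := by ext; simp
    rw [fderiv_chartMul_right (mem_of_mem_nhds target_mem_nhds_chartOne), symm_chartOne,
      modelDeriv_chart_one, h1, modelDeriv_id]
    rfl
  have hfd : ∀ x u : EuclideanSpace ℝ (Fin d),
      fderiv ℝ (fun a => fderiv ℝ (fun b => chartMul F (a, b)) (chartOne F) u) (chartOne F) x =
      fderiv ℝ (fun a => fderiv ℝ (fun b => chartMul F (a, b)) (chartOne F)) (chartOne F) x u :=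
    fun x u => by
      have := hA.hasFDerivAt.clm_apply (hasFDerivAt_const u (chartOne (d := d) F))
      rw [this.fderiv]
      simp
  have h0 : (⁅v, w⁆ : GroupLieAlgebra (𝓡 d) F) = (modelDeriv (𝓡 d) 𝓘(ℝ, EuclideanSpace ℝ (Fin d))
      (extChartAt (𝓡 d) (1 : F)) 1).inverse (lieBracketWithin ℝ (V v) (V w)
        ((extChartAt (𝓡 d) (1 : F)).symm ⁻¹' Set.univ ∩ Set.range (𝓡 d)) (chartOne F)) := by
    rw [GroupLieAlgebra.bracket_def, ← mlieBracketWithin_univ, hVdef, hVdef]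
    exact mlieBracketWithin_apply
  rw [modelDeriv_chart_one, ModelWithCorners.Boundaryless.range_eq_univ, Set.preimage_univ,
    Set.univ_inter, lieBracketWithin_univ, ContinuousLinearMap.inverse_id] at h0
  have h1 := Filter.EventuallyEq.lieBracket_vectorField_eq (𝕜 := ℝ) (hV v) (hV w)
  have h2 : ∀ x y : EuclideanSpace ℝ (Fin d),
      lieBracket ℝ (fun a => fderiv ℝ (fun b => chartMul F (a, b)) (chartOne F) x)
        (fun a => fderiv ℝ (fun b => chartMul F (a, b)) (chartOne F) y) (chartOne F) =
      fderiv ℝ (fun a => fderiv ℝ (fun b => chartMul F (a, b)) (chartOne F)) (chartOne F) x y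
      - fderiv ℝ (fun a => fderiv ℝ (fun b => chartMul F (a, b)) (chartOne F)) (chartOne F) y x :=
    fun x y => by rw [lieBracket, hfd, hfd, hAone, hAone]
  exact h0.trans (h1.trans (h2 v w))

theorem differentiableAt_chartAd :
    DifferentiableAt ℝ (chartAd (d := d) F) (chartOne F) := by
  have h1 := ContMDiffAt.comp (chartOne (d := d) F) (contMDiff_Ad (d := d) (F := F) _)
    (contMDiffAt_chart_symm (mem_of_mem_nhds target_mem_nhds_chartOne))
  exact (contMDiffAt_iff_contDiffAt.1 h1).differentiableAt (by simp)

/-- The derivative of the adjoint representation at the identity is the bracket. -/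
theorem fderiv_chartAd (v w : GroupLieAlgebra (𝓡 d) F) :
    fderiv ℝ (chartAd F) (chartOne F) v w = ⁅v, w⁆ := by
  have hm : ContDiffAt ℝ 2 (chartMul (d := d) F) (chartOne F, chartOne F) :=
    contDiffAt_chartMul.of_le ENat.LEInfty.out
  have hB := (hasFDerivAt_fderiv_left hm).differentiableAt
  -- the left multiplication by `g` is the conjugation followed by the right multiplication
  have hABC : (fun a => fderiv ℝ (fun b => chartMul (d := d) F (a, b)) (chartOne F))
      =ᶠ[𝓝 (chartOne F)] fun a =>
        (fderiv ℝ (fun b => chartMul F (b, a)) (chartOne F)).comp (chartAd F a) := by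
    filter_upwards [target_mem_nhds_chartOne] with a ha
    rw [fderiv_chartMul_right ha, fderiv_chartMul_left ha, chartAd, ContinuousLinearMap.comp_assoc]
    congr 1
    set g := (extChartAt (𝓡 d) (1 : F)).symm a
    have h1 := modelDeriv_comp (f := fun h : F => g * h * g⁻¹) (g := fun h => h * g) (x := 1)
      (mdifferentiable_mul_right (d := d) g _) (mdifferentiable_conj (d := d) g 1)
    have h2 : (fun h => h * g) ∘ (fun h : F => g * h * g⁻¹) = fun h => g * h := by
      ext h; simp
    rw [h2] at h1
    simpa only [mul_one, mul_inv_cancel] using h1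
  have hBone : fderiv ℝ (fun b => chartMul (d := d) F (b, chartOne F)) (chartOne F) =
      ContinuousLinearMap.id ℝ _ := by
    have h1 : (fun h : F => h * 1) = id := by ext; simp
    rw [fderiv_chartMul_left (mem_of_mem_nhds target_mem_nhds_chartOne), symm_chartOne,
      modelDeriv_chart_one, h1, modelDeriv_id, ContinuousLinearMap.comp_id]
  have hA := (hB.hasFDerivAt.clm_comp differentiableAt_chartAd.hasFDerivAt).congr_of_eventuallyEq
    hABC
  have h1 := fderiv_fderiv_left_apply hm v w
  rw [lie_eq_fderiv_chartMul, ← h1, hA.fderiv, hBone, chartAd_chartOne]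
  exact (add_sub_cancel_right (fderiv ℝ (chartAd F) (chartOne F) v w) _).symm

end AdjointDerivative

/-! ### The Killing form of a compact simple Lie group -/

section Killing

variable {L : Type*} [LieRing L] [LieAlgebra ℝ L] [FiniteDimensional ℝ L]

/-- For an orthonormal basis `e`, the value `B (x, x) = tr (ad x)²` is `-∑ |[x, e_i]|²`. -/
theorem killingForm_neg_of_invariant [LieAlgebra.IsSimple ℝ L] {β : LinearMap.BilinForm ℝ L}
    (hβ : IsInnerProduct β) (hinv : ∀ x y z : L, β ⁅x, y⁆ z + β y ⁅x, z⁆ = 0) (x : L) (hx : x ≠ 0) :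
    killingForm ℝ L x x < 0 := by
  obtain ⟨e, he⟩ := hβ.exists_orthonormal_basis
  have h1 : killingForm ℝ L x x = ∑ i, -β ⁅x, e i⁆ ⁅x, e i⁆ := by
    rw [killingForm, LieModule.traceForm_apply_apply, trace_eq_sum_of_orthonormal he]
    refine Finset.sum_congr rfl fun i _ => ?_
    exact eq_neg_of_add_eq_zero_left (hinv x ⁅x, e i⁆ (e i))
  have hnonneg : ∀ y, 0 ≤ β y y := fun y => by
    rcases eq_or_ne y 0 with rfl | h
    · simp
    · exact (hβ.pos y h).le
  rw [h1, Finset.sum_neg_distrib, neg_lt_zero]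
  refine (Finset.sum_nonneg fun i _ => hnonneg _).lt_of_ne' fun h0 => hx ?_
  rw [Finset.sum_eq_zero_iff_of_nonneg fun i _ => hnonneg _] at h0
  -- otherwise `x` is central, but a simple Lie algebra has no center
  have h2 : ∀ i, ⁅x, e i⁆ = 0 := fun i => by
    by_contra h
    exact (hβ.pos _ h).ne' (h0 i (Finset.mem_univ i))
  have h3 : LieAlgebra.ad ℝ L x = 0 := e.ext h2
  have h4 : x ∈ LieAlgebra.center ℝ L := fun y => by
    rw [← lie_skew, ← LieAlgebra.ad_apply ℝ, h3]
    simp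
  rcases LieAlgebra.IsSimple.eq_bot_or_eq_top (LieAlgebra.center ℝ L) with h5 | h5
  · rwa [h5, LieSubmodule.mem_bot] at h4
  · exact absurd (LieAlgebra.isLieAbelian_iff_center_eq_top ℝ L |>.2 h5)
      (LieAlgebra.IsSimple.non_abelian ℝ)

/-- If a family of maps preserves a bilinear form, then its derivative at the identity map is
skew. -/
theorem bilin_fderiv_add_eq_zero {E : Type*} [NormedAddCommGroup E] [NormedSpace ℝ E]
    (B : E →L[ℝ] E →L[ℝ] ℝ) {A : E → E →L[ℝ] E} {a : E} (hA : DifferentiableAt ℝ A a)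
    (hone : A a = ContinuousLinearMap.id ℝ E) (hB : ∀ x v w, B (A x v) (A x w) = B v w)
    (u v w : E) : B (fderiv ℝ A a u v) w + B v (fderiv ℝ A a u w) = 0 := by
  have h1 := B.hasFDerivAt_of_bilinear (hA.hasFDerivAt.clm_apply (hasFDerivAt_const v a))
    (hA.hasFDerivAt.clm_apply (hasFDerivAt_const w a))
  simp only [hB] at h1
  have h2 := DFunLike.congr_fun (h1.unique (hasFDerivAt_const (B v w) a)) u
  simp [hone] at h2
  rw [add_comm]
  exact h2

open MeasureTheory Topology

/-- Averaging an inner product over a compact group yields one that is invariant under a given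
representation. -/
theorem exists_invariant_inner {G E : Type*} [TopologicalSpace G] [Group G] [IsTopologicalGroup G]
    [CompactSpace G] [NormedAddCommGroup E] [InnerProductSpace ℝ E] {ρ : G → E →L[ℝ] E}
    (hρ : Continuous ρ) (hone : ρ 1 = ContinuousLinearMap.id ℝ E)
    (hmul : ∀ g h, ρ (g * h) = (ρ g).comp (ρ h)) :
    ∃ β : LinearMap.BilinForm ℝ E, (∀ v w, β v w = β w v) ∧ (∀ v, v ≠ 0 → 0 < β v v) ∧
      ∀ g v w, β (ρ g v) (ρ g w) = β v w := by
  borelize G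
  let μ : Measure G := Measure.haar
  -- the inverse turns the left invariance of the Haar measure into invariance under `ρ`
  let k : E → E → G → ℝ := fun v w g => inner ℝ (ρ g⁻¹ v) (ρ g⁻¹ w)
  have hk : ∀ v w, Continuous (k v w) := fun v w =>
    ((hρ.comp continuous_inv).clm_apply continuous_const).inner
      ((hρ.comp continuous_inv).clm_apply continuous_const)
  have hint : ∀ v w, Integrable (k v w) μ := fun v w =>
    (hk v w).integrable_of_hasCompactSupport (HasCompactSupport.of_compactSpace _)
  have hadd : ∀ u v w, k (u + v) w = fun g => k u w g + k v w g := fun u v w => by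
    ext g; simp only [k, map_add, inner_add_left]
  have hsmul : ∀ (c : ℝ) v w, k (c • v) w = fun g => c * k v w g := fun c v w => by
    ext g; simp only [k, map_smul, real_inner_smul_left]
  have hsymm : ∀ v w, k v w = k w v := fun v w => by
    ext g; exact real_inner_comm _ _
  have hleft : ∀ u v w, ∫ g, k (u + v) w g ∂μ = ∫ g, k u w g ∂μ + ∫ g, k v w g ∂μ :=
    fun u v w => by rw [hadd]; exact integral_add (hint _ _) (hint _ _)
  have hscal : ∀ (c : ℝ) v w, ∫ g, k (c • v) w g ∂μ = c * ∫ g, k v w g ∂μ :=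
    fun c v w => by rw [hsmul]; exact integral_const_mul _ _
  refine ⟨LinearMap.mk₂ ℝ (fun v w => ∫ g, k v w g ∂μ) hleft hscal
    (fun u v w => by rw [hsymm u, hleft, hsymm u v, hsymm u w])
    (fun c v w => by rw [hsymm v, hscal, hsymm v w]; rfl), fun v w => ?_, fun v hv => ?_,
    fun g v w => ?_⟩
  · change ∫ g, k v w g ∂μ = ∫ g, k w v g ∂μ
    rw [hsymm]
  · refine (hk v v).integral_pos_of_hasCompactSupport_nonneg_nonzero (x := 1)
      (HasCompactSupport.of_compactSpace _) (fun g => by exact real_inner_self_nonneg) ?_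
    simp only [k, inv_one, hone]
    exact inner_self_ne_zero.2 hv
  · change ∫ x, k (ρ g v) (ρ g w) x ∂μ = ∫ x, k v w x ∂μ
    rw [← integral_mul_left_eq_self _ g]
    congr 1
    ext x
    have : ∀ u, ρ (g * x)⁻¹ (ρ g u) = ρ x⁻¹ u := fun u => by
      rw [← ContinuousLinearMap.comp_apply, ← hmul]
      congr 2
      group
    simp only [k, this]

variable {d : ℕ} {F : Type*} [TopologicalSpace F] [ChartedSpace (EuclideanSpace ℝ (Fin d)) F]
  [Group F] [LieGroup (𝓡 d) ∞ F]

theorem exists_Ad_invariant_isInnerProduct [CompactSpace F] :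
    ∃ β : LinearMap.BilinForm ℝ (GroupLieAlgebra (𝓡 d) F), IsInnerProduct β ∧
      ∀ (g : F) (v w : GroupLieAlgebra (𝓡 d) F), β (Ad g v) (Ad g w) = β v w := by
  have : IsTopologicalGroup F := topologicalGroup_of_lieGroup (𝓡 d) ∞
  obtain ⟨β, h1, h2, h3⟩ := exists_invariant_inner (contMDiff_Ad (d := d) (F := F)).continuous
    (by
      have : (fun h : F => 1 * h * 1⁻¹) = id := by ext; simp
      rw [this, modelDeriv_id]) (fun g h => Ad_mul g h)
  exact ⟨β, ⟨h1, h2⟩, h3⟩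

theorem killingForm_neg [CompactSpace F]
    [LieAlgebra.IsSimple ℝ (GroupLieAlgebra (𝓡 d) F)] (x : GroupLieAlgebra (𝓡 d) F) (hx : x ≠ 0) :
    killingForm ℝ (GroupLieAlgebra (𝓡 d) F) x x < 0 := by
  obtain ⟨β, hβ, hinv⟩ := exists_Ad_invariant_isInnerProduct (d := d) (F := F)
  refine killingForm_neg_of_invariant hβ (fun u v w => ?_) x hx
  -- differentiate the invariance under the group at the identity
  have h := bilin_fderiv_add_eq_zero (LinearMap.toContinuousBilinearMap β)
    (differentiableAt_chartAd (d := d) (F := F)) chartAd_chartOne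
    (fun a v w => by exact hinv _ v w) u v w
  rw [fderiv_chartAd, fderiv_chartAd] at h
  exact h

end Killing

/-! ### Smooth maps into and out of the product manifold -/

section Product

variable {d n : ℕ} {F : Type*} [TopologicalSpace F] [ChartedSpace (EuclideanSpace ℝ (Fin d)) F]

theorem contMDiff_apply_pow (i : Fin n) :
    ContMDiff (powModel d n) (𝓡 d) ∞ (fun x : Fin n → F => x i) := by
  intro x
  rw [contMDiffAt_iff]
  refine ⟨(continuous_apply i).continuousAt, ?_⟩
  have h1 : ∀ᶠ y : Fin n → EuclideanSpace ℝ (Fin d) in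
      nhds (extChartAt (powModel d n) x x), y i ∈ (extChartAt (𝓡 d) (x i)).target :=
    (continuous_apply i).continuousAt.eventually_mem
      (extChartAt_target_mem_nhds (I := 𝓡 d) (x i))
  refine (contDiff_apply ℝ (EuclideanSpace ℝ (Fin d)) i).contDiffWithinAt.congr_of_eventuallyEq
    ?_ ?_
  · filter_upwards [mem_nhdsWithin_of_mem_nhds h1] with y hy
    exact (extChartAt (𝓡 d) (x i)).right_inv hy
  · exact (extChartAt (𝓡 d) (x i)).right_inv (mem_extChartAt_target (x i))

theorem contMDiff_pow {E H M : Type*} [NormedAddCommGroup E] [NormedSpace ℝ E] [TopologicalSpace H]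
    {I : ModelWithCorners ℝ E H} [TopologicalSpace M] [ChartedSpace H M] {φ : M → Fin n → F}
    (h : ∀ i, ContMDiff I (𝓡 d) ∞ fun x => φ x i) : ContMDiff I (powModel d n) ∞ φ := by
  intro x
  rw [contMDiffAt_iff]
  exact ⟨continuousAt_pi.2 fun i => (h i x).continuousAt,
    contDiffWithinAt_pi.2 fun i => (contMDiffAt_iff.1 (h i x)).2⟩

end Product

/-! ### The isometry from the metric of a tree to the product of bi-invariant metrics -/

section EdgeDiv

variable {n : ℕ} {F : Type*} [Group F]

/-- The map `x ↦ (x_i x_{p i}⁻¹)_i`, where the component at the root is the unit. -/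
def edgeDiv (p : Fin n → Option (Fin n)) (x : Fin n → F) : Fin n → F :=
  fun i => x i * ((p i).elim 1 x)⁻¹

/-- Successive approximations to the solution `x` of `edgeDiv p x = y`; after `k` steps the
components of rank less than `k` are correct. -/
def edgeSolve (p : Fin n → Option (Fin n)) (y : Fin n → F) : ℕ → Fin n → F
  | 0 => 1
  | k + 1 => fun i => y i * (p i).elim 1 (edgeSolve p y k)

theorem edgeSolve_succ_apply (p : Fin n → Option (Fin n)) (y : Fin n → F) (k : ℕ) (i : Fin n) :
    edgeSolve p y (k + 1) i = y i * (p i).elim 1 (edgeSolve p y k) := rfl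

theorem edgeSolve_edgeDiv {p : Fin n → Option (Fin n)} {r : Fin n → ℕ}
    (hr : ∀ i j, p i = some j → r j < r i) (x : Fin n → F) :
    ∀ (k : ℕ) (i : Fin n), r i < k → edgeSolve p (edgeDiv p x) k i = x i
  | 0, _, h => absurd h (Nat.not_lt_zero _)
  | k + 1, i, h => by
    rcases h' : p i with _ | j
    · simp [edgeSolve_succ_apply, edgeDiv, h']
    · simp [edgeSolve_succ_apply, edgeDiv, h',
        edgeSolve_edgeDiv hr x k j (by have := hr i j h'; omega)]

theorem edgeSolve_succ_eq {p : Fin n → Option (Fin n)} {r : Fin n → ℕ}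
    (hr : ∀ i j, p i = some j → r j < r i) (y : Fin n → F) :
    ∀ (k : ℕ) (i : Fin n), r i < k → edgeSolve p y (k + 1) i = edgeSolve p y k i
  | 0, _, h => absurd h (Nat.not_lt_zero _)
  | k + 1, i, h => by
    rcases h' : p i with _ | j
    · simp [edgeSolve_succ_apply, h']
    · have := edgeSolve_succ_eq hr y k j (by have := hr i j h'; omega)
      rw [edgeSolve_succ_apply, edgeSolve_succ_apply p y k, h']
      exact congrArg _ this

end EdgeDiv

section Isometry

variable {d n : ℕ} {F : Type*} [TopologicalSpace F] [ChartedSpace (EuclideanSpace ℝ (Fin d)) F]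
  [Group F]

theorem contMDiff_elim (o : Option (Fin n)) :
    ContMDiff (powModel d n) (𝓡 d) ∞ (fun x : Fin n → F => o.elim 1 x) := by
  rcases o with _ | j
  · exact contMDiff_const
  · exact contMDiff_apply_pow j

variable [LieGroup (𝓡 d) ∞ F]

theorem contMDiff_edgeDiv (p : Fin n → Option (Fin n)) :
    ContMDiff (powModel d n) (powModel d n) ∞ (edgeDiv p : (Fin n → F) → Fin n → F) :=
  contMDiff_pow fun i => (contMDiff_apply_pow i).mul (contMDiff_elim (p i)).inv

theorem contMDiff_edgeSolve (p : Fin n → Option (Fin n)) : ∀ k : ℕ,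
    ContMDiff (powModel d n) (powModel d n) ∞ fun y : Fin n → F => edgeSolve p y k
  | 0 => contMDiff_const
  | k + 1 => contMDiff_pow fun i => (contMDiff_apply_pow i).mul
      ((contMDiff_elim (p i)).comp (contMDiff_edgeSolve p k))

theorem exists_diffeomorph_edgeDiv {p : Fin n → Option (Fin n)} (hp : IsTree p) :
    ∃ φ : Diffeomorph (powModel d n) (powModel d n) (Fin n → F) (Fin n → F) ∞,
      ⇑φ = edgeDiv p := by
  obtain ⟨r, hr⟩ := hp
  have hlt : ∀ i, r i < Finset.univ.sup r + 1 := fun i =>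
    Nat.lt_succ_of_le (Finset.le_sup (Finset.mem_univ i))
  refine ⟨⟨⟨edgeDiv p, fun y => edgeSolve p y (Finset.univ.sup r + 1), fun x => ?_, fun y => ?_⟩,
    contMDiff_edgeDiv p, contMDiff_edgeSolve p _⟩, rfl⟩
  · exact funext fun i => edgeSolve_edgeDiv hr x _ i (hlt i)
  · ext i
    have h := edgeSolve_succ_eq hr y _ i (hlt i)
    change edgeSolve p y (Finset.univ.sup r + 1) i * _ = _
    rw [← h, edgeSolve_succ_apply, mul_inv_cancel_right]

section Mul

variable {E H M : Type*} [NormedAddCommGroup E] [NormedSpace ℝ E] [TopologicalSpace H]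
  {I : ModelWithCorners ℝ E H} [TopologicalSpace M] [ChartedSpace H M]

/-- At a point where both factors are the unit, the derivative of a product in a Lie group is the
sum of the derivatives. -/
theorem modelDeriv_mul {u w : M → F} {x : M} (hu : MDifferentiableAt I (𝓡 d) u x)
    (hw : MDifferentiableAt I (𝓡 d) w x) (hux : u x = 1) (hwx : w x = 1) :
    modelDeriv I (𝓡 d) (fun y => u y * w y) x =
      modelDeriv I (𝓡 d) u x + modelDeriv I (𝓡 d) w x := by
  have hm : MDifferentiable ((𝓡 d).prod (𝓡 d)) (𝓡 d) fun q : F × F => q.1 * q.2 :=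
    (contMDiff_mul (𝓡 d) ∞).mdifferentiable (by simp)
  have h1 : ∀ (a b : F) (v w : EuclideanSpace ℝ (Fin d)),
      modelDeriv ((𝓡 d).prod (𝓡 d)) (𝓡 d) (fun q : F × F => q.1 * q.2) (a, b) (v, w) =
        modelDeriv (𝓡 d) (𝓡 d) (fun z => z * b) a v + modelDeriv (𝓡 d) (𝓡 d) (fun z => a * z) b w :=
    fun a b v w => mfderiv_prod_eq_add_apply (p := (a, b)) (v := (v, w)) (hm (a, b))
  have h2 := modelDeriv_comp (f := fun y => (u y, w y)) (hm (u x, w x)) (hu.prodMk hw)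
  have h3 : modelDeriv I ((𝓡 d).prod (𝓡 d)) (fun y => (u y, w y)) x =
      (modelDeriv I (𝓡 d) u x).prod (modelDeriv I (𝓡 d) w x) := mfderiv_prodMk hu hw
  have h4 : (fun z : F => z * 1) = id := by ext; simp
  have h5 : (fun z : F => 1 * z) = id := by ext; simp
  refine h2.trans ?_
  rw [h3, hux, hwx]
  ext1 v
  refine (h1 1 1 _ _).trans ?_
  rw [h4, h5, modelDeriv_id]
  rfl

theorem modelDeriv_mul_inv {u w : M → F} {x : M} (hw : MDifferentiableAt I (𝓡 d) w x)
    (huw : MDifferentiableAt I (𝓡 d) (fun y => u y * (w y)⁻¹) x)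
    (hux : u x = 1) (hwx : w x = 1) :
    modelDeriv I (𝓡 d) (fun y => u y * (w y)⁻¹) x =
      modelDeriv I (𝓡 d) u x - modelDeriv I (𝓡 d) w x := by
  have h := modelDeriv_mul huw hw (by simp [hux, hwx]) hwx
  simp only [inv_mul_cancel_right] at h
  rw [h, add_sub_cancel_right]

end Mul

/-- In terms of left-invariant fields, the derivative of `edgeDiv` is `edgeMap`, up to the adjoint
action on each component. -/
theorem toIdentity_edgeDiv {p : Fin n → Option (Fin n)} (hp : IsTree p) (x : Fin n → F)
    (v : TangentSpace (powModel d n) x) (i : Fin n) :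
    toIdentity (edgeDiv p x) (mfderiv (powModel d n) (powModel d n) (edgeDiv p) x v) i =
      Ad ((p i).elim 1 x) (edgeMap hp (toIdentity x v) i) := by
  have hinf : (∞ : WithTop ℕ∞) ≠ 0 := by simp
  set a := (p i).elim 1 x with ha
  let u : (Fin n → F) → F := fun y => (x i)⁻¹ * y i
  let w : (Fin n → F) → F := fun y => a⁻¹ * (p i).elim 1 y
  have hu : ContMDiff (powModel d n) (𝓡 d) ∞ u := contMDiff_const.mul (contMDiff_apply_pow i)
  have hw : ContMDiff (powModel d n) (𝓡 d) ∞ w := contMDiff_const.mul (contMDiff_elim (p i))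
  have huw : ContMDiff (powModel d n) (𝓡 d) ∞ fun y => u y * (w y)⁻¹ := hu.mul hw.inv
  have hux : u x = 1 := by simp [u]
  have hwx : w x = 1 := by simp [w, a]
  have h1 := modelDeriv_comp (f := edgeDiv p)
    (((contMDiff_const (c := (edgeDiv p x i)⁻¹)).mul (contMDiff_apply_pow i)).mdifferentiable hinf
      (edgeDiv p x)) ((contMDiff_edgeDiv (d := d) p).mdifferentiable hinf x)
  have h2 := modelDeriv_comp (f := fun y => u y * (w y)⁻¹) (mdifferentiable_conj (d := d) a _)
    (huw.mdifferentiable hinf x)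
  -- with `u = x_i⁻¹ y_i` and `w = a⁻¹ y_{p i}`, the component is the conjugate of `u w⁻¹` by `a`
  have h3 : (fun h : F => a * h * a⁻¹) ∘ (fun y => u y * (w y)⁻¹) =
      (fun y : Fin n → F => (edgeDiv p x i)⁻¹ * y i) ∘ edgeDiv p := by
    ext y
    simp only [Function.comp_apply, u, w, edgeDiv, ← ha]
    group
  rw [h3, hux, hwx, inv_one, mul_one, modelDeriv_mul_inv
    (hw.mdifferentiable hinf x) (huw.mdifferentiable hinf x) hux hwx] at h2
  have h4 : modelDeriv (powModel d n) (𝓡 d) w x v = parentMap _ p (toIdentity x v) i := by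
    rw [parentMap_apply]
    rcases h : p i with _ | j
    · have : w = fun _ => a⁻¹ * 1 := by ext y; simp [w, h]
      rw [this, modelDeriv_const]
      rfl
    · have : w = fun y => (x j)⁻¹ * y j := by ext y; simp [w, h, a]
      rw [this]
      rfl
  refine (DFunLike.congr_fun (h1.symm.trans h2) v).trans ?_
  refine congrArg (Ad a) ?_
  rw [edgeMap_apply, Pi.sub_apply, ← h4]
  rfl

theorem areIsometric_treeMetric {p : Fin n → Option (Fin n)} (hp : IsTree p) :
    AreIsometric (treeMetric (GroupLieAlgebra (𝓡 d) F) hp)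
      (-killingForm ℝ (Fin n → GroupLieAlgebra (𝓡 d) F)) := by
  obtain ⟨φ, hφ⟩ := exists_diffeomorph_edgeDiv (d := d) (F := F) hp
  have key : ∀ ψ : (Fin n → F) → Fin n → F, ψ = edgeDiv p →
      ∀ (x : Fin n → F) (v : TangentSpace (powModel d n) x) (i : Fin n),
        toIdentity (ψ x) (mfderiv (powModel d n) (powModel d n) ψ x v) i =
          Ad ((p i).elim 1 x) (edgeMap hp (toIdentity x v) i) := by
    rintro _ rfl x v i
    exact toIdentity_edgeDiv hp x v i
  refine ⟨φ, fun x v w => ?_⟩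
  simp only [riemannianMetric, treeMetric_apply, LinearMap.neg_apply, killingForm_pow,
    key φ hφ, killingForm_Ad, Finset.sum_neg_distrib]

end Isometry

/-! ### The product of bi-invariant metrics is generated by a block-diagonal matrix -/

theorem standardMatrix_one {k : ℕ} (hk : k = 1) : standardMatrix k = (2 : ℝ) • 1 := by
  subst hk
  ext i j
  obtain rfl := Subsingleton.elim i 0
  obtain rfl := Subsingleton.elim j 0
  have h1 : (4 * (1 + 1) / (1 + 3) : ℝ) = 2 := by norm_num
  have h2 : ((1 : ℝ) - 0 + 1) / (1 - 0) = 2 := by norm_num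
  simp only [standardMatrix, Matrix.of_apply, lt_self_iff_false, if_false, if_true, Nat.cast_one,
    Fin.val_zero, Nat.cast_zero, h1, h2, Matrix.smul_apply, Matrix.one_apply_eq, smul_eq_mul,
    mul_one]
  exact Real.mul_self_sqrt zero_le_two

theorem blockMatrix_ones (n : ℕ) : blockMatrix (Composition.ones n) = (2 : ℝ) • 1 := by
  have h1 : (fun i : Fin (Composition.ones n).length =>
      standardMatrix ((Composition.ones n).blocksFun i)) = (2 : ℝ) • 1 :=
    funext fun i => standardMatrix_one (Composition.ones_blocksFun n i)
  rw [blockMatrix, h1, Matrix.blockDiagonal'_smul, Matrix.blockDiagonal'_one]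
  ext i j
  simp [Matrix.one_apply]

section Routine

variable {f : Type*} [LieRing f] [LieAlgebra ℝ f] [FiniteDimensional ℝ f]

theorem isGeneratedBy_ones (n : ℕ) : IsGeneratedBy (blockMatrix (Composition.ones n))
    ((1 / 4 : ℝ) • (-killingForm ℝ (Fin n → f))) := by
  intro i k X Y
  rw [blockMatrix_ones]
  simp only [LinearMap.smul_apply, LinearMap.neg_apply, killingForm_pow, map_smul, smul_eq_mul,
    Matrix.smul_apply, Matrix.one_apply]
  split_ifs with h
  · subst h
    simp
    ring
  · simpa using fun h' : k = i => absurd h'.symm h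

end Routine

theorem isRoutineEinstein_treeMetric {d n : ℕ} {F : Type*} [TopologicalSpace F]
    [ChartedSpace (EuclideanSpace ℝ (Fin d)) F] [Group F] [LieGroup (𝓡 d) ∞ F] [CompactSpace F]
    [LieAlgebra.IsSimple ℝ (GroupLieAlgebra (𝓡 d) F)] {p : Fin n → Option (Fin n)}
    (hp : IsTree p) : IsRoutineEinstein (treeMetric (GroupLieAlgebra (𝓡 d) F) hp) where
  isInvariantMetric := isInvariantMetric_treeMetric hp killingForm_neg
  isEinstein := isEinstein_treeMetric hp killingForm_neg
  exists_isometric := by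
    refine ⟨_, _, 4, isGeneratedBy_ones n, by norm_num, ?_⟩
    rw [smul_smul]
    norm_num
    exact areIsometric_treeMetric hp

/-! ### The number of trees -/

section Count

variable {n : ℕ}

/-- The parent function of the increasing tree given by a choice of a parent of each vertex `i`
among the root and the vertices below `i`. -/
def increasingTree (q : ∀ i : Fin n, Option (Fin i)) : Fin n → Option (Fin n) :=
  fun i => (q i).map (Fin.castLE i.is_lt.le)

theorem lt_of_increasingTree {q : ∀ i : Fin n, Option (Fin i)} {i j : Fin n}
    (h : increasingTree q i = some j) : j < i := by
  obtain ⟨k, -, rfl⟩ := Option.map_eq_some_iff.1 h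
  exact k.is_lt

theorem isTree_increasingTree (q : ∀ i : Fin n, Option (Fin i)) : IsTree (increasingTree q) :=
  isTree_of_lt fun _ _ h => lt_of_increasingTree h

theorem increasingTree_injective : Function.Injective (increasingTree (n := n)) := fun _ _ h =>
  funext fun i => Option.map_injective (Fin.castLE_injective _) (congrFun h i)

theorem card_increasingTree (n : ℕ) : Fintype.card (∀ i : Fin n, Option (Fin i)) = n.factorial := by
  simp only [Fintype.card_pi, Fintype.card_option, Fintype.card_fin]
  rw [Fin.prod_univ_eq_prod_range (fun i => i + 1), Finset.prod_range_add_one_eq_factorial]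

/-- The parent function of the tree in which `0` is a child of `1`, and all other vertices are
children of the root. -/
def swappedTree (m : ℕ) : Fin (m + 2) → Option (Fin (m + 2)) :=
  fun i => if i = 0 then some 1 else none

theorem isTree_swappedTree (m : ℕ) : IsTree (swappedTree m) := by
  refine ⟨fun i => if i = 0 then 1 else 0, fun i j h => ?_⟩
  by_cases hi : i = 0
  · obtain rfl : 1 = j := by simpa [swappedTree, hi] using h
    simp [hi]
  · simp [swappedTree, hi] at h

variable {f : Type*} [LieRing f] [LieAlgebra ℝ f] [FiniteDimensional ℝ f]

theorem eq_of_treeMetric_eq {X : f} (hX : killingForm ℝ f X X ≠ 0) {p p' : Fin n → Option (Fin n)}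
    (hp : ∀ {i j}, p i = some j → j < i) (hp' : ∀ {i j}, p' i = some j → j < i) {ht : IsTree p}
    {ht' : IsTree p'} (h : treeMetric f ht = treeMetric f ht') : p = p' := by
  funext i
  refine Option.ext fun j => ?_
  rcases le_or_gt i j with hij | hij
  · exact iff_of_false (fun h => (hp h).not_ge hij) fun h => (hp' h).not_ge hij
  -- the edges are read off from the scalar products of vectors in different components
  have h1 := treeMetric_single_single ht hij.ne' X
  rw [h, treeMetric_single_single ht' hij.ne' X, if_neg fun h => (hp' h).not_gt hij,
    if_neg fun h => (hp h).not_gt hij, add_zero, add_zero] at h1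
  have h2 := mul_right_cancel₀ hX h1
  by_cases h3 : p i = some j <;> by_cases h4 : p' i = some j <;> simp [h3, h4] at h2 ⊢

theorem treeMetric_increasingTree_ne_swappedTree {X : f} (hX : killingForm ℝ f X X ≠ 0) {m : ℕ}
    (q : ∀ i : Fin (m + 2), Option (Fin i)) :
    treeMetric f (isTree_increasingTree q) ≠ treeMetric f (isTree_swappedTree m) := by
  intro h
  have h0 : increasingTree q 0 = none :=
    Option.eq_none_iff_forall_ne_some.2 fun j hj => Fin.not_lt_zero j (lt_of_increasingTree hj)
  -- the children of the root are read off from the scalar products with the diagonal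
  have h1 := treeMetric_diag_single (isTree_increasingTree q) 0 X
  rw [h, treeMetric_diag_single, if_pos h0] at h1
  simp [swappedTree, hX, eq_comm] at h1

/-- The metrics of all increasing trees and of one further tree. -/
noncomputable def manyTreeMetrics (f : Type*) [LieRing f] [LieAlgebra ℝ f] (m : ℕ) :
    Option (∀ i : Fin (m + 2), Option (Fin i)) → LinearMap.BilinForm ℝ (Fin (m + 2) → f)
  | none => treeMetric f (isTree_swappedTree m)
  | some q => treeMetric f (isTree_increasingTree q)

theorem manyTreeMetrics_injective {X : f} (hX : killingForm ℝ f X X ≠ 0) (m : ℕ) :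
    Function.Injective (manyTreeMetrics f m) := by
  rintro (_ | q) (_ | q') h
  · rfl
  · exact absurd h.symm (treeMetric_increasingTree_ne_swappedTree hX q')
  · exact absurd h (treeMetric_increasingTree_ne_swappedTree hX q)
  · exact congrArg some (increasingTree_injective
      (eq_of_treeMetric_eq hX lt_of_increasingTree lt_of_increasingTree h))

theorem one_add_sqrt_two_pow_le_factorial (m : ℕ) :
    (1 + √2) ^ (m + 2) ≤ ((m + 3).factorial : ℝ) := by
  have h : √2 ≤ 3 / 2 := Real.sqrt_le_iff.2 (by norm_num)
  induction m with
  | zero =>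
    have : √2 ^ 2 = 2 := Real.sq_sqrt zero_le_two
    norm_num [Nat.factorial]
    nlinarith
  | succ m ih =>
    rw [pow_succ, Nat.factorial_succ (m + 3), Nat.cast_mul, mul_comm]
    refine mul_le_mul ?_ ih (by positivity) (by positivity)
    push_cast
    have : (0 : ℝ) ≤ m := m.cast_nonneg
    linarith

theorem one_add_sqrt_two_pow_le (m : ℕ) : (1 + √2) ^ (m + 1) ≤ ((m + 2).factorial + 1 : ℝ) := by
  rcases m with _ | m
  · have h : √2 ≤ 3 / 2 := Real.sqrt_le_iff.2 (by norm_num)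
    norm_num [Nat.factorial]
    linarith
  · exact (one_add_sqrt_two_pow_le_factorial m).trans (by linarith)

end Count

section Group

variable {d n : ℕ} {F : Type*} [TopologicalSpace F] [ChartedSpace (EuclideanSpace ℝ (Fin d)) F]
  [Group F] [LieGroup (𝓡 d) ∞ F] [CompactSpace F]
  [LieAlgebra.IsSimple ℝ (GroupLieAlgebra (𝓡 d) F)]

theorem card_le_REM {α : Type*} [Fintype α]
    {g : α → LinearMap.BilinForm ℝ (Fin n → GroupLieAlgebra (𝓡 d) F)} (hg : Function.Injective g)
    (h : ∀ a, ∃ (p : Fin n → Option (Fin n)) (hp : IsTree p), g a = treeMetric _ hp) :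
    (Fintype.card α : ℕ∞) ≤ REM d F n := by
  rw [← ENat.card_eq_coe_fintype_card]
  refine hg.encard_range.trans (Set.encard_le_encard (Set.range_subset_iff.2 fun a => ?_))
  obtain ⟨p, hp, ha⟩ := h a
  rw [ha]
  exact ⟨treeMetric_mem_criticalPoints hp killingForm_neg, isRoutineEinstein_treeMetric hp⟩

theorem factorial_add_one_le_REM (m : ℕ) : ((m + 2).factorial + 1 : ℕ) ≤ REM d F (m + 2) := by
  have : Nontrivial (GroupLieAlgebra (𝓡 d) F) := LieAlgebra.IsSimple.nontrivial ℝ _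
  obtain ⟨X, hX⟩ := exists_ne (0 : GroupLieAlgebra (𝓡 d) F)
  rw [← card_increasingTree, ← Fintype.card_option]
  refine card_le_REM (manyTreeMetrics_injective (killingForm_neg X hX).ne m) fun a => ?_
  rcases a with _ | q
  · exact ⟨_, isTree_swappedTree m, rfl⟩
  · exact ⟨_, isTree_increasingTree q, rfl⟩

theorem one_le_REM : 1 ≤ REM d F n := by
  have h := card_le_REM (d := d) (F := F) (n := n) (α := Unit)
    (g := fun _ => treeMetric _ (p := fun _ => none) (isTree_of_lt (by simp)))
    (Function.injective_of_subsingleton _) fun _ => ⟨_, _, rfl⟩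
  simpa using h

end Group

end LedgerObata

theorem mainTheorem3 {d : ℕ} {F : Type*} [TopologicalSpace F]
    [ChartedSpace (EuclideanSpace ℝ (Fin d)) F] [Group F] [LieGroup (𝓡 d) ∞ F]
    [T2Space F] [CompactSpace F] [ConnectedSpace F]
    [LieAlgebra.IsSimple ℝ (GroupLieAlgebra (𝓡 d) F)]
    (n : ℕ) (hn : 1 ≤ n) :
    LedgerObata.REM d F n ≤ LedgerObata.CPS d F n ∧
      ENNReal.ofReal ((1 + √2) ^ (n - 1)) ≤ (LedgerObata.REM d F n : ENNReal) := by
  refine ⟨Set.encard_le_encard (Set.sep_subset _ _), ?_⟩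
  match n, hn with
  | 1, _ =>
    rw [Nat.sub_self, pow_zero, ENNReal.ofReal_one]
    exact_mod_cast LedgerObata.one_le_REM
  | m + 2, _ =>
    refine (ENNReal.ofReal_le_ofReal (LedgerObata.one_add_sqrt_two_pow_le m)).trans ?_
    have h := ENat.toENNReal_le.2 (LedgerObata.factorial_add_one_le_REM (d := d) (F := F) m)
    rw [ENat.toENNReal_coe] at h
    refine le_trans (le_of_eq ?_) h
    rw [← ENNReal.ofReal_natCast]
    push_cast
    rfl
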